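/- Let $\mathfrak g$ be one of $A_N$, $B_N$, $C_N$ ($N\ge 1$) or $D_N$ ($N\ge 2$), and let $H=(H_{nl})_{1\le n,l\le N}$ be its Cartan matrix, with the nodes numbered so that the multiple bond or the fork is at the beginning of the chain. Thus every diagonal entry is $2$, and $H_{nl}=-1$ for $|n-l|=1$ and $H_{nl}=0$ for $|n-l|\ge 2$, except that $H_{21}=-2$ for $B_N$, $H_{12}=-2$ for $C_N$, and $H_{12}=H_{21}=0$, $H_{13}=H_{31}=-1$ for $D_N$. The same rules define the semi-infinite matrices of type $A,B,C,D$ (labels $n,l\ge 1$), and the rule of type $A$ with $n,l\in\mathbb Z$ defines the infinite matrix. The type III Toda field theory with matrix $H$ is the system $u_{n,xy}=\exp\big(\sum_l H_{nl}u_l\big)$, and the Toda lattice is $u_{n,tt}=\exp\big(\sum_l H_{nl}u_l\big)$. A symmetry is a smooth vector field $\xi\,\partial_x+\eta\,\partial_y+\sum_n\phi_n\,\partial_{u_n}$ (respectively $\tau\,\partial_t+\sum_n\phi_n\,\partial_{u_n}$), with coefficients depending on the independent variables and all the $u_k$ (if there are infinitely many $u_k$: each coefficient is locally a smooth function of finitely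 many variables), whose second prolongation annihilates all the equations on their solution set. Let $I,J\subseteq\mathbb R$ be nonempty open intervals. (1) On $x\in I$, $y\in J$, $u\in U$, with $U\subseteq\mathbb R^N$ nonempty, open and connected, the symmetries of the finite field theory are exactly the conformal fields $$X=\xi(x)\partial_x+\eta(y)\partial_y+(\xi_x+\eta_y)\sum_{n=1}^N c_n\,\partial_{u_n},$$ with $\xi$, $\eta$ arbitrary smooth functions on $I$, $J$, where - $A_N$: $c_n=\tfrac12 n(n-N-1)$; - $B_N$: $c_1=-\tfrac14N(N+1)$ and $c_n=\tfrac12[n(n-1)-N(N+1)]$ for $n\ge2$; - $C_N$: $c_n=\tfrac12[n(n-2)-N^2+1]$; - $D_N$: $c_1=c_2=-\tfrac14N(N-1)$ and $c_n=\tfrac12[(n-2)(n-1)-N(N-1)]$ for $n\ge3$. (2) All these symmetries are inherited from the semi-infinite theory of the same series: each is obtained from a symmetry of the semi-infinite theory (on $x\in I$, $y\in J$, all $u$) by setting $u_k=0$ and dropping $\partial_{u_k}$ for $k>N$. (3) On $x\in I$, $y\in J$, all $u$: for the series $A$ and $C$ all symmetries of the semi-infinite theory are inherited from the infinite theory (that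 is, obtained from a symmetry of it by setting $u_k=0$ and dropping $\partial_{u_k}$ for $k\le 0$), whereas for each of the series $B$ and $D$ the semi-infinite theory has a symmetry that is not inherited from the infinite theory. (4) On $t\in I$, $u\in U$, the symmetries of the finite Toda lattice are exactly the linear combinations with constant coefficients of the translation $P=\partial_t$ and the dilation $D=t\,\partial_t+2\sum_{n=1}^N c_n\,\partial_{u_n}$. -/

import Mathlib

open scoped ContDiff Topology

noncomputable section

namespace TodaSym

/-! ### Point symmetries of systems `u_{n,ij} = F_n(u)`

`p` is the number of independent variables `x_0, …, x_{p-1}`, and `ι` (finite or infinite) labels the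
dependent variables `u_n`. -/

/-- The space with coordinates `(x, (u_n)_n)`. -/
abbrev Base (p : ℕ) (ι : Type) : Type := (Fin p → ℝ) × (ι → ℝ)

/-- A vector field `∑_a ξ^a(x,u) ∂_{x_a} + ∑_n φ_n(x,u) ∂_{u_n}`
(a formal sum when `ι` is infinite). -/
structure PointField (p : ℕ) (ι : Type) where
  /-- the coefficients `ξ^a` of `∂_{x_a}` -/
  hor : Fin p → Base p ι → ℝ
  /-- the coefficients `φ_n` of `∂_{u_n}` -/
  ver : ι → Base p ι → ℝ

variable {p : ℕ} {ι κ : Type}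

/-- A function on an open set `Ω` is smooth if near each point it is a smooth function of `x` and
finitely many of the `u_n`. For finite `ι` this is ordinary smoothness. -/
def SmoothOn (Ω : Set (Base p ι)) (f : Base p ι → ℝ) : Prop :=
  ∀ z ∈ Ω, ∃ (S : Finset ι) (g : (Fin p → ℝ) × (S → ℝ) → ℝ),
    ContDiffAt ℝ ∞ g (z.1, fun k => z.2 k) ∧ ∀ᶠ w in 𝓝 z, f w = g (w.1, fun k => w.2 k)

/-- The partial derivative `∂f/∂x_i`. -/
def pdX (i : Fin p) (f : Base p ι → ℝ) (z : Base p ι) : ℝ :=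
  deriv (fun s => f (Function.update z.1 i s, z.2)) (z.1 i)

/-- The partial derivative `∂f/∂u_k`. -/
def pdU [DecidableEq ι] (k : ι) (f : Base p ι → ℝ) (z : Base p ι) : ℝ :=
  deriv (fun s => f (z.1, Function.update z.2 k s)) (z.2 k)

/-- A point of the second-order jet space: `x`, `u`, and independent values
`d1 n i` for `u_{n,i}` and `d2 n i j` for `u_{n,ij}`. -/
structure Jet2 (p : ℕ) (ι : Type) where
  pt : Base p ι
  d1 : ι → Fin p → ℝ
  d2 : ι → Fin p → Fin p → ℝ
  symm : ∀ n i j, d2 n i j = d2 n j i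

/-- The total derivative `D_i f`. -/
def totalD [DecidableEq ι] (i : Fin p) (f : Base p ι → ℝ) (q : Jet2 p ι) : ℝ :=
  pdX i f q.pt + ∑ᶠ k, q.d1 k i * pdU k f q.pt

/-- The second total derivative `D_i D_j f`. -/
def totalDD [DecidableEq ι] (i j : Fin p) (f : Base p ι → ℝ) (q : Jet2 p ι) : ℝ :=
  pdX i (pdX j f) q.pt
    + ∑ᶠ k, q.d1 k i * pdU k (pdX j f) q.pt
    + ∑ᶠ k, q.d1 k j * pdX i (pdU k f) q.pt
    + ∑ᶠ k, ∑ᶠ l, q.d1 k j * q.d1 l i * pdU l (pdU k f) q.pt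
    + ∑ᶠ k, q.d2 k i j * pdU k f q.pt

/-- The coefficient `φ_n^{ij}` of `∂_{u_{n,ij}}` in the second prolongation of `v`:
`D_iD_jφ_n - ∑_a ((D_iD_jξ^a) u_{n,a} + (D_iξ^a) u_{n,aj} + (D_jξ^a) u_{n,ai})`. -/
def prolong2 [DecidableEq ι] (v : PointField p ι) (n : ι) (i j : Fin p) (q : Jet2 p ι) : ℝ :=
  totalDD i j (v.ver n) q
    - ∑ a, (totalDD i j (v.hor a) q * q.d1 n a
        + totalD i (v.hor a) q * q.d2 n a j + totalD j (v.hor a) q * q.d2 n a i)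

/-- `v` is a smooth vector field on `Ω` and an infinitesimal Lie point symmetry there of the system
`u_{n,ij} = F_n(u)`, `n ∈ ι`: its second prolongation annihilates every `u_{n,ij} - F_n(u)`
on the solution set of the system in the jet space over `Ω`. -/
def IsSymmetry [DecidableEq ι] (i j : Fin p) (F : ι → (ι → ℝ) → ℝ) (Ω : Set (Base p ι))
    (v : PointField p ι) : Prop :=
  (∀ a, SmoothOn Ω (v.hor a)) ∧ (∀ n, SmoothOn Ω (v.ver n)) ∧
  ∀ q : Jet2 p ι, q.pt ∈ Ω → (∀ n, q.d2 n i j = F n q.pt.2) →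
    ∀ n, prolong2 v n i j q - ∑ᶠ l, v.ver l q.pt * pdU l (fun z => F n z.2) q.pt = 0

/-- Equality of vector fields on `Ω`. -/
def AgreeOn (Ω : Set (Base p ι)) (v w : PointField p ι) : Prop :=
  ∀ z ∈ Ω, (∀ a, v.hor a z = w.hor a z) ∧ ∀ n, v.ver n z = w.ver n z

/-- `v` (fields labelled by `ι`) is obtained on `Ω` from `V` (fields labelled by `κ`) by setting
`u_k = 0` for all labels `k` outside the image of `e` and dropping the corresponding `∂_{u_k}`. -/
def IsTruncation (e : ι → κ) (Ω : Set (Base p ι)) (V : PointField p κ) (v : PointField p ι) : Prop :=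
  ∀ z ∈ Ω, (∀ a, v.hor a z = V.hor a (z.1, Function.extend e z.2 0)) ∧
    ∀ n, v.ver n z = V.ver (e n) (z.1, Function.extend e z.2 0)

/-! ### Toda theories of type III -/

/-- `F_n(u) = exp (∑_l H_{nl} u_l)` (each row of `H` has finitely many nonzero entries). -/
def todaForce (H : ι → ι → ℝ) (n : ι) (u : ι → ℝ) : ℝ := Real.exp (∑ᶠ l, H n l * u l)

/-- The domain `x ∈ I`, `y ∈ J`, `u ∈ U`, with `x = x_0`, `y = x_1`. -/
def fieldDomain (I J : Set ℝ) (U : Set (ι → ℝ)) : Set (Base 2 ι) :=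
  {z | z.1 0 ∈ I ∧ z.1 1 ∈ J ∧ z.2 ∈ U}

/-- The domain `t ∈ I`, `u ∈ U`, with `t = x_0`. -/
def latticeDomain (I : Set ℝ) (U : Set (ι → ℝ)) : Set (Base 1 ι) :=
  {z | z.1 0 ∈ I ∧ z.2 ∈ U}

/-- Lie point symmetries of the field theory `u_{n,xy} = exp (∑_l H_{nl} u_l)`. -/
def IsFieldSymmetry [DecidableEq ι] (H : ι → ι → ℝ) (Ω : Set (Base 2 ι)) (v : PointField 2 ι) :
    Prop :=
  IsSymmetry 0 1 (todaForce H) Ω v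

/-- Lie point symmetries of the lattice `u_{n,tt} = exp (∑_l H_{nl} u_l)`. -/
def IsLatticeSymmetry [DecidableEq ι] (H : ι → ι → ℝ) (Ω : Set (Base 1 ι)) (v : PointField 1 ι) :
    Prop :=
  IsSymmetry 0 0 (todaForce H) Ω v

/-- The conformal field `ξ(x)∂_x + η(y)∂_y + (ξ'(x) + η'(y)) ∑_n c_n ∂_{u_n}`. -/
def conformalField (c : ι → ℝ) (ξ η : ℝ → ℝ) : PointField 2 ι where
  hor := ![fun z => ξ (z.1 0), fun z => η (z.1 1)]
  ver n z := (deriv ξ (z.1 0) + deriv η (z.1 1)) * c n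

/-- The combination `α P + β D` of the translation `P = ∂_t` and the dilation
`D = t∂_t + 2 ∑_n c_n ∂_{u_n}`. -/
def translationDilation (c : ι → ℝ) (α β : ℝ) : PointField 1 ι where
  hor _ z := α + β * z.1 0
  ver n _ := β * (2 * c n)

/-- The four classical series. -/
inductive Series
  | A | B | C | D

/-- The smallest rank in each series. -/
def Series.minRank : Series → ℕ
  | .A => 1
  | .B => 1
  | .C => 1
  | .D => 2

/-- The Cartan matrix of rank `N`. -/
def Series.cartan (N : ℕ) : Series → Matrix (Fin N) (Fin N) ℤ
  | .A => CartanMatrix.A N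
  | .B => CartanMatrix.B N
  | .C => CartanMatrix.C N
  | .D => CartanMatrix.D N

/-- The matrix `H` of the finite theory: the Cartan matrix, with the nodes of the Dynkin diagram
numbered so that the multiple bond or fork of `B`, `C`, `D` is at the beginning of the chain.
The index `i : Fin N` stands for the label `n = i + 1`. -/
def finiteH (s : Series) (N : ℕ) (i j : Fin N) : ℝ := (s.cartan N i.rev j.rev : ℝ)

/-- The matrix `2` on the diagonal, `-1` next to it, `0` elsewhere. -/
def infiniteEntry (n m : ℤ) : ℤ :=
  if n = m then 2 else if n = m + 1 ∨ m = n + 1 then -1 else 0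

/-- The matrix `H` of the infinite theory `u_{n,xy} = exp (-u_{n-1} + 2u_n - u_{n+1})`, `n ∈ ℤ`. -/
def infiniteH (n m : ℤ) : ℝ := (infiniteEntry n m : ℝ)

/-- The entries, for labels `n, m ≥ 1`, of the Cartan matrix extended to a semi-infinite chain. -/
def semiEntry : Series → ℕ → ℕ → ℤ
  | .A, n, m => infiniteEntry n m
  | .B, n, m => if n = 2 ∧ m = 1 then -2 else infiniteEntry n m
  | .C, n, m => if n = 1 ∧ m = 2 then -2 else infiniteEntry n m
  | .D, n, m =>
      if n ≤ 2 ∧ m ≤ 2 then (if n = m then 2 else 0)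
      else if (n = 1 ∧ m = 3) ∨ (n = 3 ∧ m = 1) then -1
      else infiniteEntry n m

/-- The matrix `H` of the semi-infinite theory; `i : ℕ` stands for the label `n = i + 1`. -/
def semiH (s : Series) (i j : ℕ) : ℝ := (semiEntry s (i + 1) (j + 1) : ℝ)

/-- The finite matrices are the upper left corners of the semi-infinite ones. -/
theorem finiteH_eq_semiH (s : Series) (N : ℕ) (i j : Fin N) :
    finiteH s N i j = semiH s i j := by
  have hi := i.isLt
  have hj := j.isLt
  unfold finiteH semiH
  norm_cast
  cases s <;>
    simp only [Series.cartan, CartanMatrix.A, CartanMatrix.B, CartanMatrix.C, CartanMatrix.D,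
      Matrix.of_apply, semiEntry, infiniteEntry, Fin.ext_iff, Fin.val_rev] <;>
    split_ifs <;> omega

/-- The coefficients `c_n`, `1 ≤ n ≤ N`, in the conformal fields of the finite theories. -/
def conformalCoeff (N n : ℝ) : Series → ℝ
  | .A => 1 / 2 * (n * (n - N - 1))
  | .B => if n = 1 then 1 / 4 * (-(N * (N + 1))) else 1 / 4 * (2 * (n * (n - 1) - N * (N + 1)))
  | .C => 1 / 2 * (n * (n - 2) - N ^ 2 + 1)
  | .D =>
      if n = 1 ∨ n = 2 then 1 / 4 * (-(N * (N - 1)))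
      else 1 / 4 * (2 * ((n - 2) * (n - 1) - N * (N - 1)))

/-- The same coefficients as a function on `Fin N`, where `i` stands for the label `n = i + 1`. -/
def finiteCoeff (s : Series) (N : ℕ) (i : Fin N) : ℝ := conformalCoeff N ((i : ℝ) + 1) s

/-- A symmetry `v` of a finite theory is inherited from the semi-infinite theory of the same series
if it is the truncation of a symmetry of the latter. -/
def InheritedFromSemi (s : Series) (N : ℕ) (I J : Set ℝ) (U : Set (Fin N → ℝ))
    (v : PointField 2 (Fin N)) : Prop :=
  ∃ V : PointField 2 ℕ, IsFieldSymmetry (semiH s) (fieldDomain I J Set.univ) V ∧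
    IsTruncation (fun i : Fin N => (i : ℕ)) (fieldDomain I J U) V v

/-- A symmetry `v` of a semi-infinite theory is inherited from the infinite theory if it is the
truncation (to the labels `n ≥ 1`) of a symmetry of the latter. -/
def InheritedFromInfinite (I J : Set ℝ) (v : PointField 2 ℕ) : Prop :=
  ∃ V : PointField 2 ℤ, IsFieldSymmetry infiniteH (fieldDomain I J Set.univ) V ∧
    IsTruncation (fun i : ℕ => (i : ℤ) + 1) (fieldDomain I J Set.univ) V v

end TodaSym

end

/-! The jet coordinates not fixed by the equations are free, so the symmetry condition splits into
its coefficients. In the field theory, the coefficients of `u_{n,xx}` and `u_{n,yy}` show that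
locally `ξ` depends on `x` alone and `η` on `y` alone; those of the first derivatives make each
`φ_n` affine in `u`. What remains is `φ_{n,xy} + ∑_k F_k ∂φ_n/∂u_k = (ξ_x + η_y + (Hφ)_n) F_n`. As
the rows of `H` are independent, `u` can be moved so that one of finitely many forces is multiplied
by `e^s` and the others stay fixed. Independence of `1, s, e^s, s e^s` then separates the terms
(`separate_exponentials`): `φ_n` does not depend on `u`, `φ_{n,xy} = 0`, and `Hφ = -(ξ_x + η_y)`.
For the lattice the condition is a cubic in the velocities; one extra use of the same device removes
the `u`-dependence of `τ` (`IsLatticeSymmetry.latticeDetermining`), and the outcome is `τ_tt = 0`,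
`φ_{n,tt} = 0`, `Hφ = -2τ_t`. Connectedness turns these local statements into global ones
(`SmoothOn.eq_of_box`).

The rest is linear algebra. A finite `H` has nonpositive off-diagonal entries and sends the positive
vector `-c` to `(1, …, 1)`, so a maximum principle makes it injective and `φ = (ξ_x + η_y) c`. The
formula for `c` continues to all labels with `Hc = -1`, which gives inheritance from the
semi-infinite theory.

A semi-infinite `H` has a kernel. For `A` and `C` the first row is the row of the infinite matrix
under the condition `q_0 = 0`, respectively `q_0 = q_2`, so `φ` continues to all integers. For `B`
and `D` the kernel contains `(1, 2, 2, …)` and `(1, 1, 2, 2, …)`; a symmetry of the infinite theory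
with vanishing horizontal part would make them affine in the label, which they are not. -/

noncomputable section
namespace TodaSym
variable {p : ℕ} {ι κ : Type}

/-! ### Partial derivatives as line derivatives -/

/-- The coordinate direction of `x_i`. -/
def eX (i : Fin p) : Base p ι := (Pi.single i 1, 0)

/-- The coordinate direction of `u_k`. -/
def eU [DecidableEq ι] (k : ι) : Base p ι := (0, Pi.single k 1)

theorem update_add_eq {α : Type} [DecidableEq α] (x : α → ℝ) (i : α) (s : ℝ) :
    Function.update x i (s + x i) = x + s • Pi.single i 1 := by
  ext j
  rcases eq_or_ne j i with rfl | h
  · simp [add_comm]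
  · simp [h]

/-- Line derivatives make sense on `ι → ℝ` even for infinite `ι`, where there is no norm, and they
allow arbitrary directions, such as those dual to the rows of `H`. -/
theorem pdX_eq (i : Fin p) (f : Base p ι → ℝ) (z : Base p ι) :
    pdX i f z = lineDeriv ℝ f z (eX i) := by
  have h := deriv_comp_add_const (fun s => f (Function.update z.1 i s, z.2)) (z.1 i) 0
  rw [zero_add] at h
  rw [pdX, ← h, lineDeriv]
  congr 1
  ext s
  rw [update_add_eq]
  congr 1
  simp [eX, Prod.ext_iff]

theorem pdU_eq [DecidableEq ι] (k : ι) (f : Base p ι → ℝ) (z : Base p ι) :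
    pdU k f z = lineDeriv ℝ f z (eU k) := by
  have h := deriv_comp_add_const (fun s => f (z.1, Function.update z.2 k s)) (z.2 k) 0
  rw [zero_add] at h
  rw [pdU, ← h, lineDeriv]
  congr 1
  ext s
  rw [update_add_eq]
  congr 1
  simp [eU, Prod.ext_iff]

theorem pdX_eq_fun (i : Fin p) (f : Base p ι → ℝ) :
    pdX i f = fun z => lineDeriv ℝ f z (eX i) := funext (pdX_eq i f)

theorem pdU_eq_fun [DecidableEq ι] (k : ι) (f : Base p ι → ℝ) :
    pdU k f = fun z => lineDeriv ℝ f z (eU k) := funext (pdU_eq k f)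

/-- Restriction to `x` and the `u_k` with `k ∈ S`. -/
def restr (S : Finset ι) : Base p ι →L[ℝ] (Fin p → ℝ) × (S → ℝ) :=
  (ContinuousLinearMap.fst ℝ _ _).prod
    ((ContinuousLinearMap.pi fun k : S => ContinuousLinearMap.proj (k : ι)).comp
      (ContinuousLinearMap.snd ℝ _ _))

theorem restr_apply (S : Finset ι) (z : Base p ι) :
    restr S z = (z.1, fun k : S => z.2 k) := rfl

theorem hasLineDerivAt_comp_restr (S : Finset ι) {g : (Fin p → ℝ) × (S → ℝ) → ℝ} {z : Base p ι}
    (hg : DifferentiableAt ℝ g (restr S z)) (d : Base p ι) :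
    HasLineDerivAt ℝ (fun w => g (restr S w)) (fderiv ℝ g (restr S z) (restr S d)) z d := by
  have h := hg.hasFDerivAt.hasLineDerivAt (restr S d)
  simpa [HasLineDerivAt] using h

theorem tendsto_line_zero {E : Type*} [AddCommGroup E] [Module ℝ E]
    [TopologicalSpace E] [ContinuousAdd E] [ContinuousSMul ℝ E] (z d : E) :
    Filter.Tendsto (fun t : ℝ => z + t • d) (𝓝 0) (𝓝 z) := by
  simpa using (show Continuous fun t : ℝ => z + t • d by fun_prop).tendsto 0

theorem eventually_lineDeriv_eq {f g : Base p ι → ℝ} {z : Base p ι} (h : f =ᶠ[𝓝 z] g)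
    (d : Base p ι) : (fun w => lineDeriv ℝ f w d) =ᶠ[𝓝 z] fun w => lineDeriv ℝ g w d := by
  filter_upwards [eventually_eventually_nhds.2 h] with w hw
  exact Filter.EventuallyEq.deriv_eq ((tendsto_line_zero w d).eventually hw)

theorem lineDeriv_congr {f g : Base p ι → ℝ} {z : Base p ι} (h : f =ᶠ[𝓝 z] g)
    (d : Base p ι) : lineDeriv ℝ f z d = lineDeriv ℝ g z d :=
  (eventually_lineDeriv_eq h d).eq_of_nhds

theorem eventually_contDiffAt {E : Type*} [NormedAddCommGroup E] [NormedSpace ℝ E] {g : E → ℝ}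
    {x : E} (hg : ContDiffAt ℝ ∞ g x) (n : ℕ) : ∀ᶠ y in 𝓝 x, ContDiffAt ℝ n g y :=
  (hg.of_le (by exact_mod_cast le_top)).eventually (by simp)

/-- Carries the calculus of the finite-dimensional local representative over to `f`. The identity
holds on a neighbourhood, so it can be differentiated again. -/
theorem eventually_lineDeriv_eq_fderiv {S : Finset ι} {g : (Fin p → ℝ) × (S → ℝ) → ℝ}
    {f : Base p ι → ℝ} {z : Base p ι} (hg : ContDiffAt ℝ ∞ g (restr S z))
    (h : f =ᶠ[𝓝 z] fun w => g (restr S w)) (d : Base p ι) :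
    (fun w => lineDeriv ℝ f w d) =ᶠ[𝓝 z] fun w => fderiv ℝ g (restr S w) (restr S d) := by
  refine (eventually_lineDeriv_eq h d).trans ?_
  filter_upwards [(restr S).continuous.continuousAt.eventually (eventually_contDiffAt hg 1)] with w hw
  exact (hasLineDerivAt_comp_restr S (hw.differentiableAt (by simp)) d).lineDeriv

theorem contDiffAt_fderiv_apply {E : Type*} [NormedAddCommGroup E] [NormedSpace ℝ E] {g : E → ℝ}
    {x : E} (hg : ContDiffAt ℝ ∞ g x) (d : E) : ContDiffAt ℝ ∞ (fun y => fderiv ℝ g y d) x :=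
  (hg.fderiv_right (m := ∞) (by simp)).clm_apply contDiffAt_const

/-! ### Calculus of functions depending locally on finitely many variables. -/

namespace SmoothOn

variable {Ω : Set (Base p ι)} {f g : Base p ι → ℝ}

theorem congr (hf : SmoothOn Ω f) (h : ∀ z ∈ Ω, g =ᶠ[𝓝 z] f) : SmoothOn Ω g := by
  intro z hz
  obtain ⟨S, G, hG, hfG⟩ := hf z hz
  exact ⟨S, G, hG, (h z hz).trans hfG⟩

theorem lineDeriv (hf : SmoothOn Ω f) (d : Base p ι) :
    SmoothOn Ω (fun z => lineDeriv ℝ f z d) := by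
  intro z hz
  obtain ⟨S, G, hG, hfG⟩ := hf z hz
  exact ⟨S, _, contDiffAt_fderiv_apply hG (restr S d), eventually_lineDeriv_eq_fderiv hG hfG d⟩

theorem pdX (hf : SmoothOn Ω f) (i : Fin p) : SmoothOn Ω (pdX i f) := by
  rw [pdX_eq_fun]; exact hf.lineDeriv _

theorem pdU [DecidableEq ι] (hf : SmoothOn Ω f) (k : ι) : SmoothOn Ω (pdU k f) := by
  rw [pdU_eq_fun]; exact hf.lineDeriv _

theorem hasLineDerivAt (hf : SmoothOn Ω f) {z : Base p ι} (hz : z ∈ Ω) (d : Base p ι) :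
    HasLineDerivAt ℝ f (_root_.lineDeriv ℝ f z d) z d := by
  obtain ⟨S, G, hG, hfG⟩ := hf z hz
  have h := hasLineDerivAt_comp_restr S (hG.differentiableAt (by simp)) d
  rw [(eventually_lineDeriv_eq_fderiv hG hfG d).eq_of_nhds]
  exact HasDerivAt.congr_of_eventuallyEq h ((tendsto_line_zero z d).eventually hfG)

/-- The derivative of a smooth function along a line, at any parameter. -/
theorem hasDerivAt_line (hf : SmoothOn Ω f) {z d : Base p ι} {s : ℝ} (hz : z + s • d ∈ Ω) :
    HasDerivAt (fun t => f (z + t • d)) (_root_.lineDeriv ℝ f (z + s • d) d) s := by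
  have h := hf.hasLineDerivAt hz d
  rw [HasLineDerivAt, ← sub_self s] at h
  have h2 := h.comp_sub_const s s
  refine h2.congr_of_eventuallyEq (Filter.Eventually.of_forall fun t => ?_)
  change f _ = f _
  congr 1
  module

/-- Both sides are values of the second Fréchet derivative of a local representative, which is
symmetric. -/
theorem lineDeriv_comm (hf : SmoothOn Ω f) {z : Base p ι} (hz : z ∈ Ω) (d e : Base p ι) :
    _root_.lineDeriv ℝ (fun w => _root_.lineDeriv ℝ f w d) z e =
      _root_.lineDeriv ℝ (fun w => _root_.lineDeriv ℝ f w e) z d := by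
  obtain ⟨S, G, hG, hfG⟩ := hf z hz
  have key : ∀ a b : Base p ι, _root_.lineDeriv ℝ (fun w => _root_.lineDeriv ℝ f w a) z b =
      fderiv ℝ (fderiv ℝ G) (restr S z) (restr S b) (restr S a) := by
    intro a b
    rw [(eventually_lineDeriv_eq_fderiv (contDiffAt_fderiv_apply hG (restr S a))
      (eventually_lineDeriv_eq_fderiv hG hfG a) b).eq_of_nhds]
    have hd : DifferentiableAt ℝ (fderiv ℝ G) (restr S z) :=
      (hG.fderiv_right (m := ∞) (by simp)).differentiableAt (by simp)
    rw [fderiv_clm_apply hd (differentiableAt_const _)]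
    simp
  rw [key, key]
  exact ((eventually_contDiffAt hG 2).self_of_nhds.isSymmSndFDerivAt (by simp)) _ _

theorem pdX_pdX_comm (hf : SmoothOn Ω f) {z : Base p ι} (hz : z ∈ Ω) (i j : Fin p) :
    TodaSym.pdX i (TodaSym.pdX j f) z = TodaSym.pdX j (TodaSym.pdX i f) z := by
  simp only [pdX_eq_fun]; exact hf.lineDeriv_comm hz _ _

theorem pdU_pdX_comm [DecidableEq ι] (hf : SmoothOn Ω f) {z : Base p ι} (hz : z ∈ Ω) (k : ι)
    (j : Fin p) :
    TodaSym.pdU k (TodaSym.pdX j f) z = TodaSym.pdX j (TodaSym.pdU k f) z := by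
  simp only [pdX_eq_fun, pdU_eq_fun]; exact hf.lineDeriv_comm hz _ _

theorem pdU_pdU_comm [DecidableEq ι] (hf : SmoothOn Ω f) {z : Base p ι} (hz : z ∈ Ω) (k l : ι) :
    TodaSym.pdU k (TodaSym.pdU l f) z = TodaSym.pdU l (TodaSym.pdU k f) z := by
  simp only [pdU_eq_fun]; exact hf.lineDeriv_comm hz _ _

/-- Near a point only finitely many `∂f/∂u_k` are nonzero, and every line derivative is a
combination of them. -/
theorem exists_finset [DecidableEq ι] (hf : SmoothOn Ω f) {z : Base p ι} (hz : z ∈ Ω) :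
    ∃ S : Finset ι, ∀ᶠ w in 𝓝 z, (∀ k ∉ S, TodaSym.pdU k f w = 0) ∧
      ∀ d : Base p ι, _root_.lineDeriv ℝ f w d =
        ∑ i, d.1 i * TodaSym.pdX i f w + ∑ k ∈ S, d.2 k * TodaSym.pdU k f w := by
  obtain ⟨S, G, hG, hfG⟩ := hf z hz
  refine ⟨S, ?_⟩
  have key : ∀ᶠ w in 𝓝 z, ∀ d, _root_.lineDeriv ℝ f w d = fderiv ℝ G (restr S w) (restr S d) := by
    filter_upwards [eventually_eventually_nhds.2 hfG,
      (restr S).continuous.continuousAt.eventually (eventually_contDiffAt hG 1)] with w hw hw1 d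
    rw [lineDeriv_congr hw d]
    exact (hasLineDerivAt_comp_restr S (hw1.differentiableAt (by simp)) d).lineDeriv
  filter_upwards [key] with w hw
  constructor
  · intro k hk
    rw [pdU_eq, hw]
    have : restr S (eU k : Base p ι) = 0 := by
      rw [restr_apply]
      refine Prod.ext rfl (funext fun j => ?_)
      have : (j : ι) ≠ k := fun h => hk (h ▸ j.2)
      simp [eU, this]
    rw [this, map_zero]
  · intro d
    have hd : restr S d = ∑ i, d.1 i • restr S (eX i) + ∑ k ∈ S, d.2 k • restr S (eU k) := by
      simp only [restr_apply]
      refine Prod.ext (funext fun j => ?_) (funext fun j => ?_)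
      · simp [eX, eU, Prod.fst_sum, Finset.sum_apply, Pi.single_apply]
      · simp [eX, eU, Prod.snd_sum, Finset.sum_apply, Pi.single_apply]
    simp only [pdX_eq, pdU_eq, hw]
    rw [hd]
    simp

theorem lineDeriv_eq_zero [DecidableEq ι] (hf : SmoothOn Ω f) {z : Base p ι} (hz : z ∈ Ω)
    {d : Base p ι} (hX : ∀ i, d.1 i ≠ 0 → TodaSym.pdX i f z = 0)
    (hU : ∀ k, TodaSym.pdU k f z = 0) : _root_.lineDeriv ℝ f z d = 0 := by
  obtain ⟨S, hS⟩ := hf.exists_finset hz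
  rw [hS.self_of_nhds.2 d, Finset.sum_eq_zero, Finset.sum_eq_zero, add_zero]
  · intro k _; rw [hU, mul_zero]
  · intro i _
    by_cases h : d.1 i = 0
    · rw [h, zero_mul]
    · rw [hX i h, mul_zero]

/-- A smooth function whose first derivatives vanish in the directions of `d` is constant along
`d` as long as the segment stays in the domain. -/
theorem eq_of_segment [DecidableEq ι] (hf : SmoothOn Ω f) {z d : Base p ι}
    (hseg : ∀ s ∈ Set.Icc (0 : ℝ) 1, z + s • d ∈ Ω)
    (hX : ∀ w ∈ Ω, ∀ i, d.1 i ≠ 0 → TodaSym.pdX i f w = 0)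
    (hU : ∀ w ∈ Ω, ∀ k, TodaSym.pdU k f w = 0) : f (z + d) = f z := by
  have h : ∀ s ∈ Set.Icc (0 : ℝ) 1, HasDerivAt (fun t => f (z + t • d)) 0 s := by
    intro s hs
    have := hf.hasDerivAt_line (hseg s hs)
    rwa [hf.lineDeriv_eq_zero (hseg s hs) (hX _ (hseg s hs)) (hU _ (hseg s hs))] at this
  have := (convex_Icc (0 : ℝ) 1).is_const_of_fderivWithin_eq_zero (𝕜 := ℝ)
    (f := fun t => f (z + t • d))
    (fun s hs => (h s hs).differentiableAt.differentiableWithinAt)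
    (fun s hs => by
      rw [((h s hs).hasFDerivAt.hasFDerivWithinAt).fderivWithin
        (uniqueDiffOn_Icc (by norm_num) s hs)]
      ext; simp)
    (Set.right_mem_Icc.2 zero_le_one) (Set.left_mem_Icc.2 zero_le_one)
  simpa using this

theorem eventually_line_mem (hΩ : IsOpen Ω) {z : Base p ι} (hz : z ∈ Ω) (d : Base p ι) :
    ∀ᶠ s : ℝ in 𝓝 0, z + s • d ∈ Ω :=
  (tendsto_line_zero z d).eventually (hΩ.mem_nhds hz)

/-- After subtracting `s * c`, the restriction to the line has zero derivative near `0`. -/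
theorem eventually_eq_line_of_lineDeriv (hΩ : IsOpen Ω) (hf : SmoothOn Ω f) {z d : Base p ι}
    (hz : z ∈ Ω) {c : ℝ} (h : ∀ᶠ s : ℝ in 𝓝 0, _root_.lineDeriv ℝ f (z + s • d) d = c) :
    ∀ᶠ s : ℝ in 𝓝 0, f (z + s • d) = f z + s * c := by
  obtain ⟨ε, hε, hball⟩ := Metric.eventually_nhds_iff_ball.1 (h.and (eventually_line_mem hΩ hz d))
  have hder : ∀ s ∈ Metric.ball (0 : ℝ) ε,
      HasDerivAt (fun t => f (z + t • d) - t * c) 0 s := by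
    intro s hs
    have h1 := hf.hasDerivAt_line (hball s hs).2
    rw [(hball s hs).1] at h1
    have h2 := h1.sub ((hasDerivAt_id s).mul_const c)
    rw [one_mul, sub_self] at h2
    exact h2
  have hc := fun s hs => Metric.isOpen_ball.is_const_of_deriv_eq_zero
    (𝕜 := ℝ) (s := Metric.ball (0 : ℝ) ε) (convex_ball (0 : ℝ) ε).isPreconnected
    (fun s hs => (hder s hs).differentiableAt.differentiableWithinAt)
    (fun s hs => (hder s hs).deriv) hs (Metric.mem_ball_self hε) (x := s)
  filter_upwards [Metric.ball_mem_nhds (0 : ℝ) hε] with s hs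
  have := hc s hs
  simp only [zero_smul, add_zero, zero_mul, sub_zero] at this
  linarith

theorem eventually_const_line [DecidableEq ι] (hΩ : IsOpen Ω) (hf : SmoothOn Ω f)
    (hU : ∀ w ∈ Ω, ∀ k, TodaSym.pdU k f w = 0) {z : Base p ι} (hz : z ∈ Ω) (v : ι → ℝ) :
    ∀ᶠ s : ℝ in 𝓝 0, f (z + s • ((0, v) : Base p ι)) = f z := by
  have := hf.eventually_eq_line_of_lineDeriv hΩ (d := (0, v)) hz (c := 0) ?_
  · simpa using this
  · filter_upwards [eventually_line_mem hΩ hz (0, v)] with s hs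
    exact hf.lineDeriv_eq_zero hs (by simp) (hU _ hs)

/-- A smooth function whose second derivatives in the `u_k` vanish is affine in `u`. -/
theorem eventually_affine_line [DecidableEq ι] (hΩ : IsOpen Ω) (hf : SmoothOn Ω f)
    (hUU : ∀ w ∈ Ω, ∀ k l, TodaSym.pdU k (TodaSym.pdU l f) w = 0) {z : Base p ι} (hz : z ∈ Ω)
    (v : ι → ℝ) :
    ∃ c, ∀ᶠ s : ℝ in 𝓝 0, f (z + s • ((0, v) : Base p ι)) = f z + s * c := by
  set d : Base p ι := (0, v) with hd
  have hU : ∀ w ∈ Ω, ∀ k, TodaSym.pdU k (fun w => _root_.lineDeriv ℝ f w d) w = 0 := by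
    intro w hw k
    rw [pdU_eq, hf.lineDeriv_comm hw]
    have h2 := hf.lineDeriv (eU k)
    refine h2.lineDeriv_eq_zero hw (by simp [hd]) fun l => ?_
    rw [← pdU_eq_fun]
    exact hUU w hw l k
  exact ⟨_, hf.eventually_eq_line_of_lineDeriv hΩ hz
    ((hf.lineDeriv d).eventually_const_line hΩ hU hz v)⟩

end SmoothOn

theorem pdX_congr {f g : Base p ι → ℝ} {z : Base p ι} (h : f =ᶠ[𝓝 z] g) (i : Fin p) :
    pdX i f z = pdX i g z := by
  simp only [pdX_eq]; exact lineDeriv_congr h _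

theorem pdU_congr [DecidableEq ι] {f g : Base p ι → ℝ} {z : Base p ι} (h : f =ᶠ[𝓝 z] g) (k : ι) :
    pdU k f z = pdU k g z := by
  simp only [pdU_eq]; exact lineDeriv_congr h _

@[simp] theorem pdX_const (i : Fin p) (c : ℝ) (z : Base p ι) : pdX i (fun _ => c) z = 0 := by
  simp [pdX]

@[simp] theorem pdU_const [DecidableEq ι] (k : ι) (c : ℝ) (z : Base p ι) :
    pdU k (fun _ => c) z = 0 := by
  simp [pdU]

theorem pdX_eq_zero_of_eqOn {Ω : Set (Base p ι)} (hΩ : IsOpen Ω) {f : Base p ι → ℝ}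
    (h : ∀ w ∈ Ω, f w = 0) (i : Fin p) {z : Base p ι} (hz : z ∈ Ω) : pdX i f z = 0 := by
  rw [pdX_congr (g := fun _ => 0) (Set.EqOn.eventuallyEq_of_mem h (hΩ.mem_nhds hz)), pdX_const]

theorem pdU_eq_zero_of_eqOn [DecidableEq ι] {Ω : Set (Base p ι)} (hΩ : IsOpen Ω)
    {f : Base p ι → ℝ} (h : ∀ w ∈ Ω, f w = 0) (k : ι) {z : Base p ι} (hz : z ∈ Ω) :
    pdU k f z = 0 := by
  rw [pdU_congr (g := fun _ => 0) (Set.EqOn.eventuallyEq_of_mem h (hΩ.mem_nhds hz)), pdU_const]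

/-! ### Separation of exponentials -/

/-- The span of `1, s, e^s, s e^s` is stable under differentiation, which acts on coefficients by
`(a, b, c, d) ↦ (b, 0, c + d, d)`. -/
theorem eventually_deriv_affine_add_exp {a b c d : ℝ}
    (h : ∀ᶠ s : ℝ in 𝓝 0, a + s * b + Real.exp s * (c + s * d) = 0) :
    ∀ᶠ s : ℝ in 𝓝 0, b + s * 0 + Real.exp s * ((c + d) + s * d) = 0 := by
  filter_upwards [eventually_eventually_nhds.2 h] with s hs
  have h1 : HasDerivAt (fun s : ℝ => a + s * b + Real.exp s * (c + s * d))
      (b + s * 0 + Real.exp s * ((c + d) + s * d)) s := by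
    have := (((hasDerivAt_id s).mul_const b).const_add a).add
      ((Real.hasDerivAt_exp s).mul (((hasDerivAt_id s).mul_const d).const_add c))
    refine this.congr_deriv ?_
    simp only [id]
    ring
  have h2 : (fun s : ℝ => a + s * b + Real.exp s * (c + s * d)) =ᶠ[𝓝 s] fun _ => (0 : ℝ) := hs
  rw [← h1.deriv, h2.deriv_eq, deriv_const]

/-- The value and first three derivatives at `0` give `a + c`, `b + c + d`, `c + 2d`, `c + 3d`, an
invertible system. -/
theorem eq_zero_of_affine_add_exp {a b c d : ℝ}
    (h : ∀ᶠ s : ℝ in 𝓝 0, a + s * b + Real.exp s * (c + s * d) = 0) :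
    a = 0 ∧ b = 0 ∧ c = 0 ∧ d = 0 := by
  have h1 := eventually_deriv_affine_add_exp h
  have h2 := eventually_deriv_affine_add_exp h1
  have h3 := eventually_deriv_affine_add_exp h2
  have e0 := h.self_of_nhds
  have e1 := h1.self_of_nhds
  have e2 := h2.self_of_nhds
  have e3 := h3.self_of_nhds
  simp at e0 e1 e2 e3
  refine ⟨?_, ?_, ?_, ?_⟩ <;> linarith

/-- A matrix with finite linearly independent rows and nonzero diagonal. The independence is
expressed by vectors dual to any finite set of rows. -/
structure RowIndependent (H : ι → ι → ℝ) : Prop where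
  finite_row : ∀ n, (Function.support (H n)).Finite
  diag_ne_zero : ∀ n, H n n ≠ 0
  exists_dual : ∀ (K : Finset ι) (k : ι), k ∈ K → ∃ w : ι → ℝ, ∀ j ∈ K,
    (j ≠ k → ∑ᶠ l, H j l * w l = 0) ∧ (j = k → ∑ᶠ l, H j l * w l = 1)

/-! ### Exponential forces along lines, and separation of the symmetry condition. -/

section Force

variable {H : ι → ι → ℝ}

theorem finsum_row_eq_sum (hH : ∀ n, (Function.support (H n)).Finite) (n : ι) (w : ι → ℝ) :
    ∑ᶠ l, H n l * w l = ∑ l ∈ (hH n).toFinset, H n l * w l :=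
  finsum_eq_sum_of_support_subset _ fun l hl => by
    simp only [Set.Finite.coe_toFinset]
    exact left_ne_zero_of_mul hl

theorem todaForce_pos (n : ι) (u : ι → ℝ) : 0 < todaForce H n u := Real.exp_pos _

theorem todaForce_line (hH : ∀ n, (Function.support (H n)).Finite) (n : ι) (u w : ι → ℝ) (s : ℝ) :
    todaForce H n (u + s • w) = todaForce H n u * Real.exp (s * ∑ᶠ l, H n l * w l) := by
  rw [todaForce, todaForce, ← Real.exp_add]
  congr 1
  simp only [finsum_row_eq_sum hH, Finset.mul_sum, ← Finset.sum_add_distrib]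
  refine Finset.sum_congr rfl fun l _ => ?_
  simp only [Pi.add_apply, Pi.smul_apply, smul_eq_mul]
  ring

theorem pdU_todaForce [DecidableEq ι] (hH : ∀ n, (Function.support (H n)).Finite) (k n : ι)
    (z : Base p ι) :
    pdU k (fun z => todaForce H n z.2) z = H n k * todaForce H n z.2 := by
  rw [pdU_eq, lineDeriv]
  have h : (fun t : ℝ => todaForce H n (z + t • (eU k : Base p ι)).2) =
      fun t => todaForce H n z.2 * Real.exp (t * H n k) := by
    ext t
    rw [Prod.snd_add, Prod.smul_snd, todaForce_line hH]
    congr 3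
    rw [finsum_eq_single _ k (fun l hl => by simp [eU, hl])]
    simp [eU]
  rw [h]
  have := (((hasDerivAt_id (0 : ℝ)).mul_const (H n k)).exp).const_mul (todaForce H n z.2)
  simp only [id, zero_mul, Real.exp_zero, one_mul] at this
  rw [this.deriv, mul_comm]

theorem finsum_mul_pdU_todaForce [DecidableEq ι] (hH : ∀ n, (Function.support (H n)).Finite)
    (n : ι) (a : ι → ℝ) (z : Base p ι) :
    ∑ᶠ l, a l * pdU l (fun z => todaForce H n z.2) z =
      (∑ᶠ l, H n l * a l) * todaForce H n z.2 := by
  rw [finsum_mul]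
  refine finsum_congr fun l => ?_
  rw [pdU_todaForce hH]
  ring

theorem exp_dual {c : ℝ} {P : Prop} [Decidable P] (h : (¬ P → c = 0) ∧ (P → c = 1)) (s : ℝ) :
    Real.exp (s * c) = if P then Real.exp s else 1 := by
  split_ifs with hP
  · rw [h.2 hP, mul_one]
  · rw [h.1 hP, mul_zero, Real.exp_zero]

variable [DecidableEq ι] {Ω : Set (Base p ι)}

/-- Along a direction dual to row `k₀`, the force `F_{k₀}` acquires the factor `e^s`, the other
relevant forces stay constant, `A` and the `φ_m` are affine in `s`, and `σ` and `∂φ_n/∂u_k` are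
constant. The hypothesis becomes a relation among `1, s, e^s, s e^s`, whose coefficients vanish. -/
theorem pdU_eq_of_balance (hH : RowIndependent H) (hΩ : IsOpen Ω) {A σ : Base p ι → ℝ}
    {φ : ι → Base p ι → ℝ} {n : ι} (hA : SmoothOn Ω A) (hσ : SmoothOn Ω σ)
    (hφ : ∀ m, SmoothOn Ω (φ m))
    (hAU : ∀ w ∈ Ω, ∀ k l, pdU k (pdU l A) w = 0)
    (hσU : ∀ w ∈ Ω, ∀ k, pdU k σ w = 0)
    (hφU : ∀ w ∈ Ω, ∀ m k l, pdU k (pdU l (φ m)) w = 0)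
    (hE : ∀ w ∈ Ω, A w + ∑ᶠ k, todaForce H k w.2 * pdU k (φ n) w
      - (σ w + ∑ᶠ l, H n l * φ l w) * todaForce H n w.2 = 0) {z : Base p ι} (hz : z ∈ Ω) :
    (∀ k, k ≠ n → pdU k (φ n) z = 0) ∧ pdU n (φ n) z = σ z + ∑ᶠ l, H n l * φ l z ∧ A z = 0 := by
  obtain ⟨S, hS⟩ := (hφ n).exists_finset hz
  -- `K` contains the label of every force that can occur in the equation near `z`, including `F_n`
  -- on the right. Only these rows need a dual vector.
  set K : Finset ι := insert n S with hK
  set R := (hH.finite_row n).toFinset with hR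
  have hsum : ∀ᶠ w in 𝓝 z, ∑ᶠ k, todaForce H k w.2 * pdU k (φ n) w =
      ∑ k ∈ K, todaForce H k w.2 * pdU k (φ n) w := by
    filter_upwards [hS] with w hw
    refine finsum_eq_sum_of_support_subset _ fun k hk => ?_
    by_contra hkK
    have : k ∉ S := fun h => hkK (by simp [hK, h])
    exact hk (by simp [hw.1 k this])
  have main : ∀ k₀ ∈ K, ∃ b c : ℝ, ∀ᶠ s : ℝ in 𝓝 0,
      A z + s * b + ∑ k ∈ K, todaForce H k z.2 * (if k = k₀ then Real.exp s else 1) * pdU k (φ n) z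
      - (σ z + (∑ᶠ l, H n l * φ l z + s * c)) *
        (todaForce H n z.2 * if n = k₀ then Real.exp s else 1) = 0 := by
    intro k₀ hk₀
    obtain ⟨v, hv⟩ := hH.exists_dual K k₀ hk₀
    obtain ⟨b, hb⟩ := hA.eventually_affine_line hΩ hAU hz v
    choose c hc using fun m => (hφ m).eventually_affine_line hΩ (fun w hw => hφU w hw m) hz v
    refine ⟨b, ∑ l ∈ R, H n l * c l, ?_⟩
    have hP : ∀ᶠ s : ℝ in 𝓝 0, ∀ k ∈ K,
        pdU k (φ n) (z + s • ((0, v) : Base p ι)) = pdU k (φ n) z :=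
      (Filter.eventually_all_finset K).2 fun k _ =>
        ((hφ n).pdU k).eventually_const_line hΩ (fun w hw l => hφU w hw n l k) hz v
    have hc' : ∀ᶠ s : ℝ in 𝓝 0, ∀ l ∈ R,
        φ l (z + s • ((0, v) : Base p ι)) = φ l z + s * c l :=
      (Filter.eventually_all_finset R).2 fun l _ => hc l
    filter_upwards [hb, hP, hc', hσ.eventually_const_line hΩ hσU hz v,
      (tendsto_line_zero z ((0, v) : Base p ι)).eventually hsum,
      SmoothOn.eventually_line_mem hΩ hz (0, v)] with s h1 h2 h3 h4 h5 h6
    have hF : ∀ k ∈ K, todaForce H k (z + s • ((0, v) : Base p ι)).2 =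
        todaForce H k z.2 * if k = k₀ then Real.exp s else 1 := by
      intro k hk
      rw [Prod.snd_add, Prod.smul_snd, todaForce_line hH.finite_row, exp_dual (hv k hk)]
    have := hE _ h6
    rw [h5, h1, h4, hF n (Finset.mem_insert_self _ _),
      Finset.sum_congr rfl fun k hk => by rw [hF k hk, h2 k hk],
      finsum_row_eq_sum hH.finite_row] at this
    have hsplit : ∑ l ∈ R, H n l * φ l (z + s • ((0, v) : Base p ι)) =
        ∑ l ∈ R, H n l * φ l z + s * ∑ l ∈ R, H n l * c l := by
      rw [Finset.mul_sum, ← Finset.sum_add_distrib]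
      refine Finset.sum_congr rfl fun l hl => ?_
      rw [h3 l hl]
      ring
    rw [finsum_row_eq_sum hH.finite_row, ← hR, ← hsplit]
    exact this
  have hoff : ∀ k, k ≠ n → pdU k (φ n) z = 0 := by
    intro k hk
    by_cases hkK : k ∈ K
    · obtain ⟨b, c, h⟩ := main k hkK
      simp only [hk.symm, if_false, mul_one] at h
      -- For `k ≠ n` the only term with `e^s` is `F_k ∂φ_n/∂u_k`, since `F_n` is constant along this
      -- direction.
      have h' : ∀ᶠ s : ℝ in 𝓝 0, (A z + ∑ j ∈ K.erase k, todaForce H j z.2 * pdU j (φ n) z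
          - (σ z + ∑ᶠ l, H n l * φ l z) * todaForce H n z.2)
          + s * (b - c * todaForce H n z.2)
          + Real.exp s * (todaForce H k z.2 * pdU k (φ n) z + s * 0) = 0 := by
        filter_upwards [h] with s hs
        rw [← Finset.add_sum_erase K _ hkK, if_pos rfl,
          Finset.sum_congr (g := fun j => todaForce H j z.2 * pdU j (φ n) z) rfl
          fun j hj => by rw [if_neg (Finset.ne_of_mem_erase hj), mul_one]] at hs
        linarith
      exact (mul_eq_zero.1 (eq_zero_of_affine_add_exp h').2.2.1).resolve_left
        (todaForce_pos k z.2).ne'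
    · exact hS.self_of_nhds.1 k fun h => hkK (by simp [hK, h])
  obtain ⟨b, c, h⟩ := main n (Finset.mem_insert_self _ _)
  -- With the off-diagonal derivatives gone, the direction dual to row `n` leaves `A` as the
  -- constant coefficient, and the diagonal identity as that of `e^s`.
  have h' : ∀ᶠ s : ℝ in 𝓝 0, A z + s * b + Real.exp s *
      (todaForce H n z.2 * (pdU n (φ n) z - (σ z + ∑ᶠ l, H n l * φ l z))
        + s * (-(c * todaForce H n z.2))) = 0 := by
    filter_upwards [h] with s hs
    rw [Finset.sum_eq_single n (fun k _ hk => by rw [hoff k hk, mul_zero])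
      (fun h => absurd (Finset.mem_insert_self _ _) h), if_pos rfl] at hs
    linarith
  have h0 := eq_zero_of_affine_add_exp h'
  refine ⟨hoff, ?_, h0.1⟩
  have := (mul_eq_zero.1 h0.2.2.1).resolve_left (todaForce_pos n z.2).ne'
  linarith

/-- If `A_n + ∑_k F_k ∂φ_n/∂u_k = (σ + (Hφ)_n) F_n`, where `σ` does not depend on `u` and the `A_n`,
`φ_n` are affine in `u`, then `∂φ_n/∂u_k = 0`, `A_n = 0` and `Hφ = -σ`. -/
theorem separate_exponentials (hH : RowIndependent H) (hΩ : IsOpen Ω) {A φ : ι → Base p ι → ℝ}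
    {σ : Base p ι → ℝ} (hA : ∀ n, SmoothOn Ω (A n)) (hσ : SmoothOn Ω σ)
    (hφ : ∀ m, SmoothOn Ω (φ m))
    (hAU : ∀ w ∈ Ω, ∀ n k l, pdU k (pdU l (A n)) w = 0)
    (hσU : ∀ w ∈ Ω, ∀ k, pdU k σ w = 0)
    (hφU : ∀ w ∈ Ω, ∀ m k l, pdU k (pdU l (φ m)) w = 0)
    (hE : ∀ w ∈ Ω, ∀ n, A n w + ∑ᶠ k, todaForce H k w.2 * pdU k (φ n) w
      - (σ w + ∑ᶠ l, H n l * φ l w) * todaForce H n w.2 = 0) :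
    ∀ z ∈ Ω, ∀ n, (∀ k, pdU k (φ n) z = 0) ∧ A n z = 0 ∧ ∑ᶠ l, H n l * φ l z + σ z = 0 := by
  have key := fun n z hz => pdU_eq_of_balance (z := z) hH hΩ (hA n) hσ hφ
    (fun w hw => hAU w hw n) hσU hφU (fun w hw => hE w hw n) hz
  intro z hz n
  -- Differentiate `∂φ_n/∂u_n = σ + (Hφ)_n` with respect to `u_n`. The left side gives `0`; on the
  -- right only `H_nn ∂φ_n/∂u_n` survives, and `H_nn ≠ 0`.
  have hnn : pdU n (φ n) z = 0 := by
    have h1 : (fun w => pdU n (φ n) w) =ᶠ[𝓝 z]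
        fun w => σ w + ∑ l ∈ (hH.finite_row n).toFinset, H n l * φ l w := by
      filter_upwards [hΩ.mem_nhds hz] with w hw
      rw [(key n w hw).2.1, finsum_row_eq_sum hH.finite_row]
    have h2 := pdU_congr h1 n
    rw [show pdU n (fun w => pdU n (φ n) w) z = 0 from hφU z hz n n n] at h2
    have h3 : HasDerivAt (fun s : ℝ => σ (z + s • (eU n : Base p ι)) +
        ∑ l ∈ (hH.finite_row n).toFinset, H n l * φ l (z + s • (eU n : Base p ι)))
        (pdU n σ z + ∑ l ∈ (hH.finite_row n).toFinset, H n l * pdU n (φ l) z) 0 := by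
      simp only [pdU_eq]
      exact (hσ.hasLineDerivAt hz _).add
        (HasDerivAt.fun_sum fun l _ => ((hφ l).hasLineDerivAt hz _).const_mul _)
    rw [pdU_eq, lineDeriv, h3.deriv, hσU z hz, zero_add,
      Finset.sum_eq_single n (fun l _ hl => by rw [(key l z hz).1 n hl.symm, mul_zero])
        (fun h => absurd ((hH.finite_row n).mem_toFinset.2 (hH.diag_ne_zero n)) h)] at h2
    exact (mul_eq_zero.1 h2.symm).resolve_left (hH.diag_ne_zero n)
  obtain ⟨h1, h2, h3⟩ := key n z hz
  refine ⟨fun k => ?_, h3, by rw [add_comm, ← h2, hnn]⟩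
  rcases eq_or_ne k n with rfl | hk
  exacts [hnn, h1 k hk]

end Force

/-! ### The Cartan matrices -/

theorem finsum_eq_sum_comp {M : Type*} [AddCommMonoid M] {e : ι → κ} (he : Function.Injective e)
    [Fintype ι] {f : κ → M} (hf : ∀ k ∉ Set.range e, f k = 0) : ∑ᶠ k, f k = ∑ i, f (e i) := by
  classical
  rw [finsum_eq_sum_of_support_subset f (s := Finset.univ.image e), Finset.sum_image he.injOn]
  intro k hk
  by_contra h
  exact hk (hf k fun ⟨i, hi⟩ => h (by simp [← hi]))

/-- A matrix with nonpositive off-diagonal entries and a positive vector with positive image is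
injective. -/
theorem eq_zero_of_sum_eq_zero [Fintype ι] {H : ι → ι → ℝ}
    (hoff : ∀ i j, i ≠ j → H i j ≤ 0) {d : ι → ℝ} (hd : ∀ i, 0 < d i)
    (hHd : ∀ i, 0 < ∑ j, H i j * d j) {w : ι → ℝ} (hw : ∀ i, ∑ j, H i j * w j = 0) : w = 0 := by
  classical
  suffices h : ∀ w : ι → ℝ, (∀ i, ∑ j, H i j * w j = 0) → ∀ i, w i ≤ 0 by
    ext i
    refine le_antisymm (h w hw i) ?_
    have := h (-w) (fun i => by simp [hw i]) i
    simpa using this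
  clear! w
  intro w hw i
  -- Maximum principle: where `w / d` attains its maximum `ρ`, the sign of the off-diagonal entries
  -- gives `ρ (Hd)_n ≤ (Hw)_n = 0`, so `ρ ≤ 0`.
  obtain ⟨n, -, hn⟩ := Finset.exists_max_image Finset.univ (fun i => w i / d i) ⟨i, Finset.mem_univ i⟩
  set ρ := w n / d n with hρ
  have hle : ∀ j, w j ≤ ρ * d j := fun j => (div_le_iff₀ (hd j)).1 (hn j (Finset.mem_univ j))
  have hwn : w n = ρ * d n := by rw [hρ, div_mul_cancel₀ _ (hd n).ne']
  have h1 : ρ * ∑ j, H n j * d j ≤ ∑ j, H n j * w j := by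
    rw [Finset.mul_sum]
    refine Finset.sum_le_sum fun j _ => ?_
    rcases eq_or_ne n j with rfl | hj
    · rw [hwn]; exact le_of_eq (by ring)
    · nlinarith [hoff n j hj, hle j]
  rw [hw n] at h1
  have h2 : ρ ≤ 0 := by
    by_contra h
    exact absurd h1 (not_le.2 (mul_pos (not_le.1 h) (hHd n)))
  exact (hle i).trans (mul_nonpos_of_nonpos_of_nonneg h2 (hd i).le)

theorem semiH_self (s : Series) (n : ℕ) : semiH s n n = 2 := by
  unfold semiH
  cases s <;> simp only [semiEntry, infiniteEntry] <;> split_ifs <;> first | omega | norm_num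

theorem semiH_nonpos (s : Series) {n l : ℕ} (h : n ≠ l) : semiH s n l ≤ 0 := by
  unfold semiH
  cases s <;> simp only [semiEntry, infiniteEntry] <;> split_ifs <;> first | omega | norm_num

/-- The margin is `2` and not `1` because in type `D` the first node is joined to the third. -/
theorem semiH_eq_zero (s : Series) {n l : ℕ} (h : n + 2 < l) :
    semiH s n l = 0 := by
  unfold semiH
  cases s <;> simp only [semiEntry, infiniteEntry] <;> split_ifs <;> first | omega | norm_num

theorem finite_support_semiH (s : Series) (n : ℕ) : (Function.support (semiH s n)).Finite := by
  refine (Set.finite_Iio (n + 3)).subset fun l hl => ?_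
  by_contra h
  exact hl (semiH_eq_zero s (by simp at h; omega))

theorem finsum_semiH_eq_sum_range (s : Series) (n N : ℕ) (hN : n + 3 ≤ N) (q : ℕ → ℝ) :
    ∑ᶠ l, semiH s n l * q l = ∑ l ∈ Finset.range N, semiH s n l * q l := by
  refine finsum_eq_sum_of_support_subset _ fun l hl => ?_
  by_contra h
  exact hl (by simp only [semiH_eq_zero s (show n + 2 < l by simp at h; omega), zero_mul])

theorem finsum_semiH_A_zero (q : ℕ → ℝ) : ∑ᶠ l, semiH .A 0 l * q l = 2 * q 0 - q 1 := by
  rw [finsum_semiH_eq_sum_range .A 0 3 le_rfl]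
  simp [Finset.sum_range_succ, semiH, semiEntry, infiniteEntry]
  ring

theorem finsum_semiH_B_zero (q : ℕ → ℝ) : ∑ᶠ l, semiH .B 0 l * q l = 2 * q 0 - q 1 := by
  rw [finsum_semiH_eq_sum_range .B 0 3 le_rfl]
  simp [Finset.sum_range_succ, semiH, semiEntry, infiniteEntry]
  ring

theorem finsum_semiH_B_one (q : ℕ → ℝ) :
    ∑ᶠ l, semiH .B 1 l * q l = -2 * q 0 + 2 * q 1 - q 2 := by
  rw [finsum_semiH_eq_sum_range .B 1 4 le_rfl]
  simp [Finset.sum_range_succ, semiH, semiEntry, infiniteEntry]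
  ring

theorem finsum_semiH_C_zero (q : ℕ → ℝ) : ∑ᶠ l, semiH .C 0 l * q l = 2 * q 0 - 2 * q 1 := by
  rw [finsum_semiH_eq_sum_range .C 0 3 le_rfl]
  simp [Finset.sum_range_succ, semiH, semiEntry, infiniteEntry]
  ring

theorem finsum_semiH_D_zero (q : ℕ → ℝ) : ∑ᶠ l, semiH .D 0 l * q l = 2 * q 0 - q 2 := by
  rw [finsum_semiH_eq_sum_range .D 0 3 le_rfl]
  simp [Finset.sum_range_succ, semiH, semiEntry, infiniteEntry]
  ring

theorem finsum_semiH_D_one (q : ℕ → ℝ) : ∑ᶠ l, semiH .D 1 l * q l = 2 * q 1 - q 2 := by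
  rw [finsum_semiH_eq_sum_range .D 1 4 le_rfl]
  simp [Finset.sum_range_succ, semiH, semiEntry, infiniteEntry]
  ring

theorem finsum_semiH_D_two (q : ℕ → ℝ) :
    ∑ᶠ l, semiH .D 2 l * q l = -q 0 - q 1 + 2 * q 2 - q 3 := by
  rw [finsum_semiH_eq_sum_range .D 2 5 le_rfl]
  simp [Finset.sum_range_succ, semiH, semiEntry, infiniteEntry]
  ring

/-- The first row from which on the semi-infinite matrix is that of type `A`. -/
def Series.regularRow : Series → ℕ
  | .A => 1
  | .B => 2
  | .C => 1
  | .D => 3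

theorem semiH_regular {s : Series} {n : ℕ} (hn : s.regularRow ≤ n) (l : ℕ) :
    semiH s n l = infiniteH (n + 1) (l + 1) := by
  unfold semiH infiniteH
  norm_cast
  cases s <;> simp only [semiEntry, Series.regularRow] at hn ⊢ <;> push_cast <;> split_ifs <;>
    first | rfl | omega

theorem infiniteH_self (n : ℤ) : infiniteH n n = 2 := by simp [infiniteH, infiniteEntry]

theorem infiniteH_succ (n : ℤ) : infiniteH n (n + 1) = -1 := by simp [infiniteH, infiniteEntry]

theorem infiniteH_pred (n : ℤ) : infiniteH n (n - 1) = -1 := by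
  simp only [infiniteH, infiniteEntry]
  split_ifs <;> first | omega | norm_num

theorem infiniteH_eq_zero {n l : ℤ} (h : l ≠ n - 1) (h0 : l ≠ n) (h1 : l ≠ n + 1) :
    infiniteH n l = 0 := by
  unfold infiniteH infiniteEntry
  split_ifs <;> first | omega | norm_num

theorem support_infiniteH (n : ℤ) :
    Function.support (infiniteH n) ⊆ (({n - 1, n, n + 1} : Finset ℤ) : Set ℤ) := by
  intro l hl
  by_contra h
  simp only [Finset.coe_insert, Finset.coe_singleton, Set.mem_insert_iff, Set.mem_singleton_iff,
    not_or] at h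
  exact hl (infiniteH_eq_zero h.1 h.2.1 h.2.2)

theorem finsum_infiniteH (n : ℤ) (q : ℤ → ℝ) :
    ∑ᶠ l, infiniteH n l * q l = -q (n - 1) + 2 * q n - q (n + 1) := by
  rw [finsum_eq_sum_of_support_subset (s := {n - 1, n, n + 1}) _
    fun l hl => support_infiniteH n (left_ne_zero_of_mul hl)]
  rw [Finset.sum_insert (by simp; omega), Finset.sum_insert (by simp), Finset.sum_singleton,
    infiniteH_self, infiniteH_succ, infiniteH_pred]
  ring

theorem finsum_semiH_regular {s : Series} {n : ℕ} (hn : s.regularRow ≤ n + 1) (q : ℕ → ℝ) :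
    ∑ᶠ l, semiH s (n + 1) l * q l = -q n + 2 * q (n + 1) - q (n + 2) := by
  rw [finsum_eq_sum_of_support_subset (s := {n, n + 1, n + 2})]
  · rw [Finset.sum_insert (by simp), Finset.sum_insert (by simp), Finset.sum_singleton,
      semiH_self, semiH_regular hn, semiH_regular hn]
    have h1 : infiniteH ((n + 1 : ℕ) + 1) (n + 1) = -1 := by
      simpa using infiniteH_pred ((n + 1 : ℕ) + 1)
    have h2 : infiniteH ((n + 1 : ℕ) + 1) ((n + 2 : ℕ) + 1) = -1 := by
      have := infiniteH_succ ((n + 1 : ℕ) + 1)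
      push_cast at this ⊢
      rwa [show (n : ℤ) + 2 + 1 = n + 1 + 1 + 1 by ring]
    rw [h1, h2]
    ring
  · intro l hl
    by_contra h
    simp only [Finset.coe_insert, Finset.coe_singleton, Set.mem_insert_iff,
      Set.mem_singleton_iff, not_or] at h
    refine hl ?_
    simp only [semiH_regular hn]
    rw [infiniteH_eq_zero, zero_mul] <;> push_cast <;> omega

/-- The coefficients of the conformal fields, continued to all labels, satisfy `H c = -1`. -/
theorem finsum_semiH_conformalCoeff (s : Series) (N : ℝ) (n : ℕ) :
    ∑ᶠ l : ℕ, semiH s n l * conformalCoeff N ((l : ℝ) + 1) s = -1 := by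
  cases s
  · rcases n with _ | n
    · rw [finsum_semiH_A_zero]
      simp only [conformalCoeff]; push_cast; ring
    · rw [finsum_semiH_regular (by simp [Series.regularRow])]
      simp only [conformalCoeff]; push_cast; ring
  · rcases n with _ | _ | n
    · rw [finsum_semiH_B_zero]
      norm_num [conformalCoeff]; ring
    · rw [finsum_semiH_B_one]
      norm_num [conformalCoeff]; ring
    · rw [finsum_semiH_regular (by simp [Series.regularRow])]
      have h1 : ((n + 1 : ℕ) : ℝ) + 1 ≠ 1 := by norm_cast; omega
      have h2 : ((n + 1 + 1 : ℕ) : ℝ) + 1 ≠ 1 := by norm_cast; omega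
      have h3 : ((n + 1 + 2 : ℕ) : ℝ) + 1 ≠ 1 := by norm_cast; omega
      simp only [conformalCoeff, if_neg h1, if_neg h2, if_neg h3]
      push_cast; ring
  · rcases n with _ | n
    · rw [finsum_semiH_C_zero]
      simp only [conformalCoeff]; push_cast; ring
    · rw [finsum_semiH_regular (by simp [Series.regularRow])]
      simp only [conformalCoeff]; push_cast; ring
  · rcases n with _ | _ | _ | n
    · rw [finsum_semiH_D_zero]
      norm_num [conformalCoeff]; ring
    · rw [finsum_semiH_D_one]
      norm_num [conformalCoeff]; ring
    · rw [finsum_semiH_D_two]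
      norm_num [conformalCoeff]; ring
    · rw [finsum_semiH_regular (by simp [Series.regularRow])]
      have key : ∀ m : ℕ, ¬(((n + 2 + m : ℕ) : ℝ) + 1 = 1 ∨ ((n + 2 + m : ℕ) : ℝ) + 1 = 2) := by
        intro m
        rintro (h | h) <;> norm_cast at h <;> omega
      have h1 := key 0
      have h2 := key 1
      have h3 := key 2
      simp only [conformalCoeff]
      rw [if_neg h1, if_neg h2, if_neg h3]
      push_cast; ring

/-- This zero at the first dropped node is what lets the semi-infinite identity `Hc = -1` restrict
to the finite matrix. The minimal ranks keep the label `N + 1` off the exceptional nodes. -/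
theorem conformalCoeff_succ (s : Series) {N : ℕ} (hN : s.minRank ≤ N) :
    conformalCoeff N ((N : ℝ) + 1) s = 0 := by
  cases s <;> simp only [Series.minRank] at hN <;> simp only [conformalCoeff]
  · ring
  · rw [if_neg (by simp; omega)]; ring
  · ring
  · rw [if_neg]
    · ring
    · rintro (h | h) <;> norm_cast at h <;> omega

/-- Makes `-c` the positive vector with positive image required by the maximum principle. -/
theorem finiteCoeff_neg (s : Series) {N : ℕ} (i : Fin N) (hN : s.minRank ≤ N) :
    finiteCoeff s N i < 0 := by
  obtain ⟨i, hi⟩ := i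
  have hi' : (i : ℝ) + 1 ≤ N := by exact_mod_cast hi
  have hi0 : (0 : ℝ) ≤ i := i.cast_nonneg
  cases s <;> simp only [Series.minRank] at hN <;> simp only [finiteCoeff, conformalCoeff]
  · nlinarith
  · split_ifs
    · nlinarith
    · nlinarith
  · nlinarith
  · have hN' : (2 : ℝ) ≤ N := by exact_mod_cast hN
    split_ifs
    · nlinarith
    · rename_i h
      have h2 : (2 : ℝ) ≤ i := by
        push Not at h
        have h1 : i ≠ 0 := fun h0 => h.1 (by simp [h0])
        have h2 : i ≠ 1 := fun h0 => h.2 (by norm_num [h0])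
        exact_mod_cast (show 2 ≤ i by omega)
      nlinarith

/-- `H c = -1` for the finite matrices. -/
theorem sum_finiteH_finiteCoeff (s : Series) {N : ℕ} (hN : s.minRank ≤ N) (i : Fin N) :
    ∑ j, finiteH s N i j * finiteCoeff s N j = -1 := by
  rw [← finsum_semiH_conformalCoeff s N i]
  simp only [finiteH_eq_semiH, finiteCoeff]
  rw [finsum_eq_sum_comp (e := fun j : Fin N => (j : ℕ)) Fin.val_injective]
  intro k hk
  have hkN : N ≤ k := by
    by_contra h
    exact hk ⟨⟨k, not_le.1 h⟩, rfl⟩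
  -- Of the dropped columns, the first meets a zero coefficient, and the later ones have zero
  -- entries in the rows of the block.
  rcases hkN.eq_or_lt with rfl | hlt
  · rw [conformalCoeff_succ s hN, mul_zero]
  · have hi := i.isLt
    have h0 : semiH s i k = 0 := by
      unfold semiH
      cases s <;> simp only [Series.minRank] at hN <;> simp only [semiEntry, infiniteEntry] <;>
        split_ifs <;> first | omega | norm_num
    rw [h0, zero_mul]

theorem finiteH_injective (s : Series) {N : ℕ} (hN : s.minRank ≤ N) {w : Fin N → ℝ}
    (hw : ∀ i, ∑ j, finiteH s N i j * w j = 0) : w = 0 := by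
  refine eq_zero_of_sum_eq_zero (d := fun j => -finiteCoeff s N j) ?_ ?_ ?_ hw
  · intro i j h
    rw [finiteH_eq_semiH]
    exact semiH_nonpos s (Fin.val_ne_of_ne h)
  · intro i
    exact neg_pos.2 (finiteCoeff_neg s i hN)
  · intro i
    simp [sum_finiteH_finiteCoeff s hN]

theorem exists_finiteH_dual (s : Series) {N : ℕ} (hN : s.minRank ≤ N) (b : Fin N → ℝ) :
    ∃ w : Fin N → ℝ, ∀ i, ∑ j, finiteH s N i j * w j = b i := by
  have hinj : Function.Injective (Matrix.mulVecLin (Matrix.of (finiteH s N))) := by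
    rw [injective_iff_map_eq_zero]
    intro w hw
    exact finiteH_injective s hN fun i => congrFun hw i
  obtain ⟨w, hw⟩ := (LinearMap.injective_iff_surjective.1 hinj) b
  exact ⟨w, fun i => congrFun hw i⟩

/-- Finitely many rows lie in a block that is a finite Cartan matrix, hence invertible. Solve there
and extend by zero: columns outside the block then contribute nothing. -/
theorem exists_dual_of_embedding {s : Series} {N : ℕ} (hN : s.minRank ≤ N) {H : κ → κ → ℝ}
    {e : Fin N → κ} (he : Function.Injective e) (hH : ∀ i j, H (e i) (e j) = finiteH s N i j)
    {K : Finset κ} (hK : ∀ j ∈ K, j ∈ Set.range e) (k : κ) :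
    ∃ w : κ → ℝ, ∀ j ∈ K,
      (j ≠ k → ∑ᶠ l, H j l * w l = 0) ∧ (j = k → ∑ᶠ l, H j l * w l = 1) := by
  classical
  obtain ⟨w, hw⟩ := exists_finiteH_dual s hN fun i => if e i = k then 1 else 0
  refine ⟨Function.extend e w 0, fun j hj => ?_⟩
  obtain ⟨i, rfl⟩ := hK j hj
  have : ∑ᶠ l, H (e i) l * Function.extend e w 0 l = if e i = k then 1 else 0 := by
    rw [finsum_eq_sum_comp he, ← hw]
    · simp only [hH, he.extend_apply]
    · intro l hl
      rw [Function.extend_apply' _ _ _ fun ⟨a, ha⟩ => hl ⟨a, ha⟩]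
      simp
  rw [this]
  exact ⟨fun h => if_neg h, fun h => if_pos h⟩

theorem rowIndependent_finiteH (s : Series) {N : ℕ} (hN : s.minRank ≤ N) :
    RowIndependent (finiteH s N) where
  finite_row _ := Set.toFinite _
  diag_ne_zero n := by rw [finiteH_eq_semiH, semiH_self]; norm_num
  exists_dual _ k _ := exists_dual_of_embedding hN Function.injective_id (fun _ _ => rfl) (by simp) k

theorem rowIndependent_semiH (s : Series) : RowIndependent (semiH s) where
  finite_row := finite_support_semiH s
  diag_ne_zero n := by rw [semiH_self]; norm_num
  exists_dual K k _ := by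
    -- `K.sup id + 1` would already cover the indices in `K`; one more guarantees rank `2` for type
    -- `D`.
    have hN : s.minRank ≤ K.sup id + 2 := by
      have : s.minRank ≤ 2 := by cases s <;> simp [Series.minRank]
      omega
    refine exists_dual_of_embedding hN (e := fun i => (i : ℕ)) Fin.val_injective
      (fun i j => (finiteH_eq_semiH s _ i j).symm) (fun j hj => ?_) k
    have : j ≤ K.sup id := Finset.le_sup (f := id) hj
    exact ⟨⟨j, by omega⟩, rfl⟩

theorem rowIndependent_infiniteH : RowIndependent infiniteH where
  finite_row n := (Finset.finite_toSet _).subset (support_infiniteH n)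
  diag_ne_zero n := by rw [infiniteH_self]; norm_num
  exists_dual K k _ := by
    -- The window from `-M` to `M` contains `K`, and its block is the type `A` matrix of rank `2M +
    -- 1`.
    set M : ℕ := K.sup Int.natAbs with hM
    refine exists_dual_of_embedding (s := .A) (N := 2 * M + 1) (by simp [Series.minRank])
      (e := fun i => (i : ℤ) - M) (fun i j h => ?_) (fun i j => ?_) (fun j hj => ?_) k
    · simp only [sub_left_inj, Nat.cast_inj] at h
      exact Fin.ext h
    · rw [finiteH_eq_semiH]
      simp only [infiniteH, semiH, semiEntry, infiniteEntry]
      push_cast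
      split_ifs <;> first | rfl | omega
    · have : j.natAbs ≤ M := Finset.le_sup (f := Int.natAbs) hj
      exact ⟨⟨(j + M).toNat, by omega⟩, by simp; omega⟩

/-! ### Determining equations of the field theory -/

namespace SmoothOn

variable {Ω : Set (Base p ι)} {f g : Base p ι → ℝ}

theorem add (hf : SmoothOn Ω f) (hg : SmoothOn Ω g) : SmoothOn Ω fun z => f z + g z := by
  classical
  intro z hz
  obtain ⟨S, F, hF, hfF⟩ := hf z hz
  obtain ⟨T, G, hG, hgG⟩ := hg z hz
  let r : (Fin p → ℝ) × (↥(S ∪ T) → ℝ) → (Fin p → ℝ) × (S → ℝ) :=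
    fun y => (y.1, fun k => y.2 ⟨k, Finset.mem_union_left _ k.2⟩)
  let r' : (Fin p → ℝ) × (↥(S ∪ T) → ℝ) → (Fin p → ℝ) × (T → ℝ) :=
    fun y => (y.1, fun k => y.2 ⟨k, Finset.mem_union_right _ k.2⟩)
  have hr : ContDiff ℝ ∞ r := by fun_prop
  have hr' : ContDiff ℝ ∞ r' := by fun_prop
  refine ⟨S ∪ T, fun y => F (r y) + G (r' y), ?_, ?_⟩
  · exact (ContDiffAt.comp (g := F) (f := r) _ hF hr.contDiffAt).add
      (ContDiffAt.comp (g := G) (f := r') _ hG hr'.contDiffAt)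
  · filter_upwards [hfF, hgG] with w hw hw'
    rw [hw, hw']

theorem const_mul (hf : SmoothOn Ω f) (c : ℝ) : SmoothOn Ω fun z => c * f z := by
  intro z hz
  obtain ⟨S, F, hF, hfF⟩ := hf z hz
  refine ⟨S, fun y => c * F y, contDiffAt_const.mul hF, ?_⟩
  filter_upwards [hfF] with w hw
  rw [hw]

theorem of_base {h : (Fin p → ℝ) → ℝ} (hh : ∀ z ∈ Ω, ContDiffAt ℝ ∞ h z.1) :
    SmoothOn Ω fun z => h z.1 := fun z hz =>
  ⟨∅, fun y => h y.1, ContDiffAt.comp (g := h) (f := Prod.fst) _ (hh z hz) contDiffAt_fst,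
    Filter.Eventually.of_forall fun _ => rfl⟩

/-- Freezing `u` leaves an ordinary smooth function of `x`; this is how smoothness of `ξ`, `η` and
of symmetries evaluated at `u = 0` is obtained. -/
theorem contDiffAt_base (hf : SmoothOn Ω f) {x : Fin p → ℝ} {u : ι → ℝ} (hx : (x, u) ∈ Ω) :
    ContDiffAt ℝ ∞ (fun x' => f (x', u)) x := by
  obtain ⟨S, F, hF, hfF⟩ := hf _ hx
  have h1 : ContDiff ℝ ∞ fun x' : Fin p → ℝ => (x', fun k : S => u k) := by fun_prop
  refine (ContDiffAt.comp (g := F) (f := fun x' : Fin p → ℝ => (x', fun k : S => u k)) x hF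
    h1.contDiffAt).congr_of_eventuallyEq ?_
  have h2 : Filter.Tendsto (fun x' : Fin p → ℝ => ((x', u) : Base p ι)) (𝓝 x) (𝓝 (x, u)) :=
    Continuous.tendsto (by fun_prop) x
  exact h2.eventually hfF

theorem lineDeriv_linear (hf : SmoothOn Ω f) (hg : SmoothOn Ω g) (a b : ℝ) (d : Base p ι)
    {z : Base p ι} (hz : z ∈ Ω) : _root_.lineDeriv ℝ (fun w => a * f w + b * g w) z d =
      a * _root_.lineDeriv ℝ f z d + b * _root_.lineDeriv ℝ g z d :=
  HasDerivAt.deriv (((hf.hasLineDerivAt hz d).const_mul a).add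
    ((hg.hasLineDerivAt hz d).const_mul b))

theorem pdU_linear [DecidableEq ι] (hf : SmoothOn Ω f) (hg : SmoothOn Ω g) (a b : ℝ) (k : ι)
    {z : Base p ι} (hz : z ∈ Ω) : TodaSym.pdU k (fun w => a * f w + b * g w) z =
      a * TodaSym.pdU k f z + b * TodaSym.pdU k g z := by
  simp only [pdU_eq, hf.lineDeriv_linear hg a b _ hz]

variable [DecidableEq ι]

theorem pdU_pdX_eq_zero (hf : SmoothOn Ω f) (hΩ : IsOpen Ω) {k : ι}
    (hU : ∀ w ∈ Ω, TodaSym.pdU k f w = 0) (i : Fin p) :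
    ∀ w ∈ Ω, TodaSym.pdU k (TodaSym.pdX i f) w = 0 := fun w hw => by
  rw [hf.pdU_pdX_comm hw]
  exact pdX_eq_zero_of_eqOn hΩ hU i hw

theorem pdU_pdU_pdX_eq_zero (hf : SmoothOn Ω f) (hΩ : IsOpen Ω) {k l : ι}
    (hUU : ∀ w ∈ Ω, TodaSym.pdU k (TodaSym.pdU l f) w = 0) (i : Fin p) :
    ∀ w ∈ Ω, TodaSym.pdU k (TodaSym.pdU l (TodaSym.pdX i f)) w = 0 := fun w hw => by
  rw [pdU_congr (g := TodaSym.pdX i (TodaSym.pdU l f))]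
  · exact (hf.pdU l).pdU_pdX_eq_zero hΩ hUU i w hw
  · filter_upwards [hΩ.mem_nhds hw] with y hy
    exact hf.pdU_pdX_comm hy l i

end SmoothOn

section Field

variable [DecidableEq ι] {Ω : Set (Base p ι)} {f : Base p ι → ℝ}

theorem totalD_of_pdU_eq_zero (i : Fin p) {q : Jet2 p ι} (hU : ∀ k, pdU k f q.pt = 0) :
    totalD i f q = pdX i f q.pt := by
  simp [totalD, hU]

theorem totalDD_of_pdU_eq_zero (hΩ : IsOpen Ω) (hf : SmoothOn Ω f) (i j : Fin p) {q : Jet2 p ι}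
    (hq : q.pt ∈ Ω) (hU : ∀ w ∈ Ω, ∀ k, pdU k f w = 0) :
    totalDD i j f q = pdX i (pdX j f) q.pt := by
  have h1 : ∀ k, pdU k (pdX j f) q.pt = 0 := fun k =>
    hf.pdU_pdX_eq_zero hΩ (fun w hw => hU w hw k) j _ hq
  have h2 : ∀ k, pdX i (pdU k f) q.pt = 0 := fun k =>
    pdX_eq_zero_of_eqOn hΩ (fun w hw => hU w hw k) i hq
  have h3 : ∀ k l, pdU l (pdU k f) q.pt = 0 := fun k l =>
    pdU_eq_zero_of_eqOn hΩ (fun w hw => hU w hw k) l hq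
  simp [totalDD, h1, h2, h3, hU _ hq]

theorem finsum_single_mul (k : ι) (f : ι → ℝ) : ∑ᶠ l, (Pi.single k 1 : ι → ℝ) l * f l = f k := by
  rw [finsum_eq_single _ k fun l hl => by simp [hl]]
  simp

/-- The determining equations of the symmetries of the field theory with matrix `H`. -/
structure FieldDetermining (H : ι → ι → ℝ) (Ω : Set (Base 2 ι)) (v : PointField 2 ι) : Prop where
  smooth_hor : ∀ a, SmoothOn Ω (v.hor a)
  smooth_ver : ∀ n, SmoothOn Ω (v.ver n)
  pdX_hor_zero : ∀ z ∈ Ω, pdX 1 (v.hor 0) z = 0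
  pdX_hor_one : ∀ z ∈ Ω, pdX 0 (v.hor 1) z = 0
  pdU_hor : ∀ z ∈ Ω, ∀ a k, pdU k (v.hor a) z = 0
  pdU_ver : ∀ z ∈ Ω, ∀ n k, pdU k (v.ver n) z = 0
  pdX_pdX_ver : ∀ z ∈ Ω, ∀ n, pdX 0 (pdX 1 (v.ver n)) z = 0
  balance : ∀ z ∈ Ω, ∀ n,
    ∑ᶠ l, H n l * v.ver l z + (pdX 0 (v.hor 0) z + pdX 1 (v.hor 1) z) = 0

variable {H : ι → ι → ℝ} {Ω : Set (Base 2 ι)} {v : PointField 2 ι}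

/-- Under these equations the prolonged coefficient reduces to `-(ξ_x + η_y) F_n`, which cancels
against `(Hφ)_n F_n`. -/
theorem FieldDetermining.isFieldSymmetry (hH : ∀ n, (Function.support (H n)).Finite)
    (hΩ : IsOpen Ω) (h : FieldDetermining H Ω v) : IsFieldSymmetry H Ω v := by
  refine ⟨h.smooth_hor, h.smooth_ver, fun q hq hF n => ?_⟩
  rw [finsum_mul_pdU_todaForce hH, prolong2, Fin.sum_univ_two,
    totalDD_of_pdU_eq_zero hΩ (h.smooth_ver n) _ _ hq fun w hw => h.pdU_ver w hw n,
    totalDD_of_pdU_eq_zero hΩ (h.smooth_hor 0) _ _ hq fun w hw => h.pdU_hor w hw 0,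
    totalDD_of_pdU_eq_zero hΩ (h.smooth_hor 1) _ _ hq fun w hw => h.pdU_hor w hw 1,
    totalD_of_pdU_eq_zero _ (h.pdU_hor _ hq 0), totalD_of_pdU_eq_zero _ (h.pdU_hor _ hq 0),
    totalD_of_pdU_eq_zero _ (h.pdU_hor _ hq 1), totalD_of_pdU_eq_zero _ (h.pdU_hor _ hq 1),
    h.pdX_pdX_ver _ hq, pdX_eq_zero_of_eqOn hΩ h.pdX_hor_zero 0 hq,
    (h.smooth_hor 1).pdX_pdX_comm hq, pdX_eq_zero_of_eqOn hΩ h.pdX_hor_one 1 hq,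
    h.pdX_hor_zero _ hq, h.pdX_hor_one _ hq, q.symm n 1 0, hF]
  linear_combination (-todaForce H n q.pt.2) * h.balance _ hq n

/-- The jet over `z` with given first derivatives `a_n`, `b_n` in `x`, `y`, mixed derivatives `F_n`
and pure second derivatives `c_n`, `d_n`. -/
def planeJet (z : Base 2 ι) (F a b c d : ι → ℝ) : Jet2 2 ι where
  pt := z
  d1 n := ![a n, b n]
  d2 n i j := !![c n, F n; F n, d n] i j
  symm n i j := by fin_cases i <;> fin_cases j <;> rfl

theorem totalD_zero_planeJet (f : Base 2 ι → ℝ) (z : Base 2 ι) (F a b c d : ι → ℝ) :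
    totalD 0 f (planeJet z F a b c d) = pdX 0 f z + ∑ᶠ k, a k * pdU k f z := rfl

theorem totalD_one_planeJet (f : Base 2 ι → ℝ) (z : Base 2 ι) (F a b c d : ι → ℝ) :
    totalD 1 f (planeJet z F a b c d) = pdX 1 f z + ∑ᶠ k, b k * pdU k f z := rfl

theorem totalDD_planeJet (f : Base 2 ι → ℝ) (z : Base 2 ι) (F a b c d : ι → ℝ) :
    totalDD 0 1 f (planeJet z F a b c d) = pdX 0 (pdX 1 f) z
      + ∑ᶠ k, a k * pdU k (pdX 1 f) z + ∑ᶠ k, b k * pdX 0 (pdU k f) z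
      + ∑ᶠ k, ∑ᶠ l, b k * a l * pdU l (pdU k f) z + ∑ᶠ k, F k * pdU k f z := rfl

theorem IsFieldSymmetry.planeJet_eq (hH : ∀ n, (Function.support (H n)).Finite)
    (h : IsFieldSymmetry H Ω v) {z : Base 2 ι} (hz : z ∈ Ω) (a b c d : ι → ℝ) (n : ι) :
    let q := planeJet z (fun n => todaForce H n z.2) a b c d
    totalDD 0 1 (v.ver n) q
      - (totalDD 0 1 (v.hor 0) q * a n + totalD 0 (v.hor 0) q * todaForce H n z.2
          + totalD 1 (v.hor 0) q * c n
        + (totalDD 0 1 (v.hor 1) q * b n + totalD 0 (v.hor 1) q * d n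
          + totalD 1 (v.hor 1) q * todaForce H n z.2))
      - (∑ᶠ l, H n l * v.ver l z) * todaForce H n z.2 = 0 := by
  have := h.2.2 (planeJet z (fun n => todaForce H n z.2) a b c d) hz (fun n => rfl) n
  rw [finsum_mul_pdU_todaForce hH, prolong2, Fin.sum_univ_two] at this
  exact this

theorem eq_zero_of_forall_add_finsum {c : ℝ} {f : ι → ℝ}
    (h : ∀ a : ι → ℝ, c + ∑ᶠ k, a k * f k = 0) : c = 0 ∧ ∀ k, f k = 0 := by
  have h0 : c = 0 := by simpa using h 0
  refine ⟨h0, fun k => ?_⟩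
  have := h (Pi.single k 1)
  rwa [finsum_single_mul, h0, zero_add] at this

/-- The condition is tested on jets with chosen first and pure second derivatives until only the
relation among the forces is left, to which `separate_exponentials` applies. -/
theorem IsFieldSymmetry.fieldDetermining [Nonempty ι] (hH : RowIndependent H) (hΩ : IsOpen Ω)
    (h : IsFieldSymmetry H Ω v) : FieldDetermining H Ω v := by
  have hξs := h.1 0
  have hηs := h.1 1
  have hφs := h.2.1
  obtain ⟨n₀⟩ := ‹Nonempty ι›
  have hξ : ∀ z ∈ Ω, pdX 1 (v.hor 0) z = 0 ∧ ∀ k, pdU k (v.hor 0) z = 0 := fun z hz =>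
    eq_zero_of_forall_add_finsum fun b => by
      -- Two jets differing only in `u_{n,xx}` isolate its coefficient `D_y ξ`; it vanishes for
      -- every choice `b` of the `y`-derivatives. The same is done below with `u_{n,yy}` and `D_x
      -- η`.
      have h0 := h.planeJet_eq hH.finite_row hz 0 b 0 0 n₀
      have h1 := h.planeJet_eq hH.finite_row hz 0 b 1 0 n₀
      simp only [totalDD_planeJet, totalD_zero_planeJet, totalD_one_planeJet, Pi.zero_apply,
        Pi.one_apply] at h0 h1
      linarith
  have hη : ∀ z ∈ Ω, pdX 0 (v.hor 1) z = 0 ∧ ∀ k, pdU k (v.hor 1) z = 0 := fun z hz =>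
    eq_zero_of_forall_add_finsum fun a => by
      have h0 := h.planeJet_eq hH.finite_row hz a 0 0 0 n₀
      have h1 := h.planeJet_eq hH.finite_row hz a 0 0 1 n₀
      simp only [totalDD_planeJet, totalD_zero_planeJet, totalD_one_planeJet, Pi.zero_apply,
        Pi.one_apply] at h0 h1
      linarith
  have hE : ∀ z ∈ Ω, ∀ n a b, totalDD 0 1 (v.ver n)
      (planeJet z (fun n => todaForce H n z.2) a b 0 0)
      - (pdX 0 (v.hor 0) z + pdX 1 (v.hor 1) z) * todaForce H n z.2
      - (∑ᶠ l, H n l * v.ver l z) * todaForce H n z.2 = 0 := by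
    intro z hz n a b
    have h0 := h.planeJet_eq hH.finite_row hz a b 0 0 n
    simp only at h0
    rw [totalDD_of_pdU_eq_zero hΩ hξs _ _ hz fun w hw => (hξ w hw).2,
      totalDD_of_pdU_eq_zero hΩ hηs _ _ hz fun w hw => (hη w hw).2,
      totalD_of_pdU_eq_zero _ (hξ _ hz).2, totalD_of_pdU_eq_zero _ (hξ _ hz).2,
      totalD_of_pdU_eq_zero _ (hη _ hz).2, totalD_of_pdU_eq_zero _ (hη _ hz).2] at h0
    change totalDD 0 1 (v.ver n) _ - (pdX 0 (pdX 1 (v.hor 0)) z * _ + pdX 0 (v.hor 0) z * _ +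
      pdX 1 (v.hor 0) z * _ + (pdX 0 (pdX 1 (v.hor 1)) z * _ + pdX 0 (v.hor 1) z * _ +
      pdX 1 (v.hor 1) z * _)) - _ = 0 at h0
    rw [pdX_eq_zero_of_eqOn hΩ (fun w hw => (hξ w hw).1) 0 hz, hηs.pdX_pdX_comm hz,
      pdX_eq_zero_of_eqOn hΩ (fun w hw => (hη w hw).1) 1 hz] at h0
    simp only [Pi.zero_apply, mul_zero, zero_mul, add_zero, zero_add] at h0
    linarith
  -- The condition is now a polynomial in the first derivatives, at most linear in each of `a` and
  -- `b`. Zero and unit vectors read off its constant, linear and bilinear coefficients.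
  have hE0 : ∀ z ∈ Ω, ∀ n, pdX 0 (pdX 1 (v.ver n)) z
      + ∑ᶠ k, todaForce H k z.2 * pdU k (v.ver n) z
      - (pdX 0 (v.hor 0) z + pdX 1 (v.hor 1) z + ∑ᶠ l, H n l * v.ver l z) *
        todaForce H n z.2 = 0 := by
    intro z hz n
    have := hE z hz n 0 0
    simp only [totalDD_planeJet, Pi.zero_apply, zero_mul, finsum_zero, add_zero] at this
    linarith
  have hUX : ∀ z ∈ Ω, ∀ n k, pdU k (pdX 1 (v.ver n)) z = 0 := by
    intro z hz n k
    have := hE z hz n (Pi.single k 1) 0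
    simp only [totalDD_planeJet, Pi.zero_apply, zero_mul, finsum_zero, add_zero,
      finsum_single_mul] at this
    linarith [hE0 z hz n]
  have hXU : ∀ z ∈ Ω, ∀ n k, pdX 0 (pdU k (v.ver n)) z = 0 := by
    intro z hz n k
    have := hE z hz n 0 (Pi.single k 1)
    simp only [totalDD_planeJet, Pi.zero_apply, mul_zero, zero_mul, finsum_zero, add_zero,
      finsum_single_mul] at this
    linarith [hE0 z hz n]
  have hUU : ∀ z ∈ Ω, ∀ n k l, pdU k (pdU l (v.ver n)) z = 0 := by
    intro z hz n k l
    have := hE z hz n (Pi.single k 1) (Pi.single l 1)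
    simp only [totalDD_planeJet, finsum_single_mul, hUX z hz, hXU z hz, mul_assoc] at this
    simp only [← mul_finsum, finsum_single_mul] at this
    linarith [hE0 z hz n]
  have key := separate_exponentials hH hΩ (A := fun n => pdX 0 (pdX 1 (v.ver n)))
    (σ := fun z => pdX 0 (v.hor 0) z + pdX 1 (v.hor 1) z) (φ := v.ver)
    (fun n => ((hφs n).pdX 1).pdX 0) ((hξs.pdX 0).add (hηs.pdX 1)) hφs
    (fun w hw n k l => pdU_eq_zero_of_eqOn hΩ (fun y hy =>
      ((hφs n).pdX 1).pdU_pdX_eq_zero hΩ (fun x hx => hUX x hx n l) 0 y hy) k hw)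
    (fun w hw k => by
      have := (hξs.pdX 0).pdU_linear (hηs.pdX 1) 1 1 k hw
      simp only [one_mul] at this
      rw [this, hξs.pdU_pdX_eq_zero hΩ (fun y hy => (hξ y hy).2 k) 0 w hw,
        hηs.pdU_pdX_eq_zero hΩ (fun y hy => (hη y hy).2 k) 1 w hw, add_zero])
    hUU hE0
  exact
    { smooth_hor := h.1
      smooth_ver := hφs
      pdX_hor_zero := fun z hz => (hξ z hz).1
      pdX_hor_one := fun z hz => (hη z hz).1
      pdU_hor := fun z hz a k => by
        fin_cases a
        exacts [(hξ z hz).2 k, (hη z hz).2 k]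
      pdU_ver := fun z hz n k => (key z hz n).1 k
      pdX_pdX_ver := fun z hz n => (key z hz n).2.1
      balance := fun z hz n => (key z hz n).2.2 }

end Field

/-! ### Determining equations of the lattice -/

theorem cubic_coeff_eq_zero {a b c d : ℝ}
    (h : ∀ s : ℝ, a + s * b + s ^ 2 * c + s ^ 3 * d = 0) : a = 0 ∧ b = 0 ∧ c = 0 ∧ d = 0 := by
  have h0 := h 0
  have h1 := h 1
  have h2 := h (-1)
  have h3 := h 2
  norm_num at h0 h1 h2 h3
  refine ⟨?_, ?_, ?_, ?_⟩ <;> linarith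

section Lattice

/-- The determining equations of the symmetries of the lattice with matrix `H`. -/
structure LatticeDetermining [DecidableEq ι] (H : ι → ι → ℝ) (Ω : Set (Base 1 ι))
    (v : PointField 1 ι) : Prop where
  smooth_hor : ∀ a, SmoothOn Ω (v.hor a)
  smooth_ver : ∀ n, SmoothOn Ω (v.ver n)
  pdU_hor : ∀ z ∈ Ω, ∀ a k, pdU k (v.hor a) z = 0
  pdU_ver : ∀ z ∈ Ω, ∀ n k, pdU k (v.ver n) z = 0
  pdX_pdX_hor : ∀ z ∈ Ω, pdX 0 (pdX 0 (v.hor 0)) z = 0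
  pdX_pdX_ver : ∀ z ∈ Ω, ∀ n, pdX 0 (pdX 0 (v.ver n)) z = 0
  balance : ∀ z ∈ Ω, ∀ n, ∑ᶠ l, H n l * v.ver l z + 2 * pdX 0 (v.hor 0) z = 0

variable [DecidableEq ι] {H : ι → ι → ℝ} {Ω : Set (Base 1 ι)} {v : PointField 1 ι}

theorem LatticeDetermining.isLatticeSymmetry (hH : ∀ n, (Function.support (H n)).Finite)
    (hΩ : IsOpen Ω) (h : LatticeDetermining H Ω v) : IsLatticeSymmetry H Ω v := by
  refine ⟨h.smooth_hor, h.smooth_ver, fun q hq hF n => ?_⟩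
  rw [finsum_mul_pdU_todaForce hH, prolong2, Fin.sum_univ_one,
    totalDD_of_pdU_eq_zero hΩ (h.smooth_ver n) _ _ hq fun w hw => h.pdU_ver w hw n,
    totalDD_of_pdU_eq_zero hΩ (h.smooth_hor 0) _ _ hq fun w hw => h.pdU_hor w hw 0,
    totalD_of_pdU_eq_zero _ (h.pdU_hor _ hq 0), h.pdX_pdX_ver _ hq, h.pdX_pdX_hor _ hq, hF]
  linear_combination (-todaForce H n q.pt.2) * h.balance _ hq n

/-- The jet over `z` of a curve with first derivatives `a_n` and second derivatives `F_n`. -/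
def lineJet (z : Base 1 ι) (F a : ι → ℝ) : Jet2 1 ι where
  pt := z
  d1 n _ := a n
  d2 n _ _ := F n
  symm _ _ _ := rfl

variable [Fintype ι]

/-- `∑_k a_k ∂f/∂u_k`. -/
def gradU (f : Base 1 ι → ℝ) (z : Base 1 ι) (a : ι → ℝ) : ℝ := ∑ k, a k * pdU k f z

/-- `∑_{k,l} a_k a_l ∂²f/∂u_k∂u_l`. -/
def hessU (f : Base 1 ι → ℝ) (z : Base 1 ι) (a : ι → ℝ) : ℝ :=
  ∑ k, ∑ l, a k * a l * pdU l (pdU k f) z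

theorem gradU_smul (f : Base 1 ι → ℝ) (z : Base 1 ι) (s : ℝ) (a : ι → ℝ) :
    gradU f z (s • a) = s * gradU f z a := by
  simp only [gradU, Finset.mul_sum, Pi.smul_apply, smul_eq_mul, mul_assoc]

theorem gradU_add (f : Base 1 ι → ℝ) (z : Base 1 ι) (a b : ι → ℝ) :
    gradU f z (a + b) = gradU f z a + gradU f z b := by
  simp only [gradU, ← Finset.sum_add_distrib, Pi.add_apply, add_mul]

theorem gradU_single (f : Base 1 ι → ℝ) (z : Base 1 ι) (k : ι) :
    gradU f z (Pi.single k 1) = pdU k f z := by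
  rw [gradU, Finset.sum_eq_single k (fun l _ hl => by simp [hl]) (by simp)]
  simp

theorem hessU_smul (f : Base 1 ι → ℝ) (z : Base 1 ι) (s : ℝ) (a : ι → ℝ) :
    hessU f z (s • a) = s ^ 2 * hessU f z a := by
  simp only [hessU, Finset.mul_sum, Pi.smul_apply, smul_eq_mul]
  exact Finset.sum_congr rfl fun k _ => Finset.sum_congr rfl fun l _ => by ring

/-- Polarization: on the lattice both total derivatives use the same velocities, so only the
quadratic form of the Hessian is visible. -/
theorem hessU_polar {f : Base 1 ι → ℝ} (hf : SmoothOn Ω f) {z : Base 1 ι} (hz : z ∈ Ω)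
    (k l : ι) : 2 * pdU l (pdU k f) z = hessU f z (Pi.single k 1 + Pi.single l 1)
      - hessU f z (Pi.single k 1) - hessU f z (Pi.single l 1) := by
  have key : ∀ i j : ι, ∑ a, ∑ b, (Pi.single i 1 : ι → ℝ) a * (Pi.single j 1 : ι → ℝ) b *
      pdU b (pdU a f) z = pdU j (pdU i f) z := by
    intro i j
    rw [Finset.sum_eq_single i (fun l _ hl => by simp [hl]) (by simp),
      Finset.sum_eq_single j (fun l _ hl => by simp [hl]) (by simp)]
    simp
  have hadd : hessU f z (Pi.single k 1 + Pi.single l 1) = hessU f z (Pi.single k 1)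
      + hessU f z (Pi.single l 1) + (pdU l (pdU k f) z + pdU k (pdU l f) z) := by
    rw [← key k l, ← key l k]
    simp only [hessU, ← Finset.sum_add_distrib]
    exact Finset.sum_congr rfl fun a _ => Finset.sum_congr rfl fun b _ => by
      simp only [Pi.add_apply]; ring
  rw [hadd, hf.pdU_pdU_comm hz l k]
  ring

theorem totalD_lineJet (f : Base 1 ι → ℝ) (z : Base 1 ι) (F a : ι → ℝ) :
    totalD 0 f (lineJet z F a) = pdX 0 f z + gradU f z a := by
  rw [totalD, finsum_eq_sum_of_fintype]
  rfl

theorem totalDD_lineJet {f : Base 1 ι → ℝ} (hf : SmoothOn Ω f) {z : Base 1 ι} (hz : z ∈ Ω)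
    (F a : ι → ℝ) : totalDD 0 0 f (lineJet z F a) =
      pdX 0 (pdX 0 f) z + 2 * gradU (pdX 0 f) z a + hessU f z a + gradU f z F := by
  have h : ∑ k, a k * pdX 0 (pdU k f) z = gradU (pdX 0 f) z a :=
    Finset.sum_congr rfl fun k _ => by rw [hf.pdU_pdX_comm hz]
  simp only [totalDD, finsum_eq_sum_of_fintype]
  change pdX 0 (pdX 0 f) z + gradU (pdX 0 f) z a + ∑ k, a k * pdX 0 (pdU k f) z + hessU f z a
    + gradU f z F = _
  rw [h]
  ring

/-- The coefficients of the powers of the first derivatives in the symmetry condition. -/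
theorem IsLatticeSymmetry.split (hH : ∀ n, (Function.support (H n)).Finite)
    (h : IsLatticeSymmetry H Ω v) {z : Base 1 ι} (hz : z ∈ Ω) (a : ι → ℝ) (n : ι) :
    pdX 0 (pdX 0 (v.ver n)) z + gradU (v.ver n) z (fun k => todaForce H k z.2)
      - (2 * pdX 0 (v.hor 0) z + ∑ᶠ l, H n l * v.ver l z) * todaForce H n z.2 = 0 ∧
    2 * gradU (pdX 0 (v.ver n)) z a - (pdX 0 (pdX 0 (v.hor 0)) z
      + gradU (v.hor 0) z (fun k => todaForce H k z.2)) * a n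
      - 2 * gradU (v.hor 0) z a * todaForce H n z.2 = 0 ∧
    hessU (v.ver n) z a - 2 * gradU (pdX 0 (v.hor 0)) z a * a n = 0 ∧
    -(hessU (v.hor 0) z a * a n) = 0 := by
  -- With velocities `s • a` the condition is a cubic in `s`; the four conjuncts are its
  -- coefficients.
  refine cubic_coeff_eq_zero fun s => ?_
  have := h.2.2 (lineJet z (fun n => todaForce H n z.2) (s • a)) hz (fun n => rfl) n
  rw [finsum_mul_pdU_todaForce hH, prolong2, Fin.sum_univ_one, totalDD_lineJet (h.2.1 n) hz,
    totalDD_lineJet (h.1 0) hz, totalD_lineJet] at this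
  simp only [gradU_smul, hessU_smul] at this
  simp only [lineJet, Pi.smul_apply, smul_eq_mul] at this
  linarith

/-- The cubic coefficient makes `τ` affine in `u`, and the quadratic one expresses the Hessian of
`φ_n` through `τ_{tu}`, so third `u`-derivatives of `φ_n` vanish. The linear coefficient contains
forces multiplied by `τ_u`; separating them gives `τ_u = 0`, hence `φ_n` is affine and the constant
coefficient has the form treated by `separate_exponentials`. -/
theorem IsLatticeSymmetry.latticeDetermining [Nonempty ι] (hH : RowIndependent H)
    (hΩ : IsOpen Ω) (h : IsLatticeSymmetry H Ω v) : LatticeDetermining H Ω v := by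
  have hτs := h.1 0
  have hφs := h.2.1
  have hsplit := fun z hz => h.split hH.finite_row (z := z) hz
  have hτUU : ∀ z ∈ Ω, ∀ k l, pdU k (pdU l (v.hor 0)) z = 0 := by
    have hzero : ∀ z ∈ Ω, ∀ a, hessU (v.hor 0) z a = 0 := by
      intro z hz a
      by_cases ha : a = 0
      · simp [ha, hessU]
      · obtain ⟨n, hn⟩ := Function.ne_iff.1 ha
        have := (hsplit z hz a n).2.2.2
        exact (mul_eq_zero.1 (neg_eq_zero.1 this)).resolve_right hn
    intro z hz k l
    have := hessU_polar hτs hz l k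
    rw [hzero z hz, hzero z hz, hzero z hz] at this
    linarith
  have hφUU : ∀ z ∈ Ω, ∀ n k l, pdU k (pdU l (v.ver n)) z =
      (Pi.single k 1 : ι → ℝ) n * pdU l (pdX 0 (v.hor 0)) z +
      (Pi.single l 1 : ι → ℝ) n * pdU k (pdX 0 (v.hor 0)) z := by
    intro z hz n k l
    have h0 := hessU_polar (hφs n) hz l k
    have h1 := (hsplit z hz (Pi.single l 1 + Pi.single k 1) n).2.2.1
    have h2 := (hsplit z hz (Pi.single l 1) n).2.2.1
    have h3 := (hsplit z hz (Pi.single k 1) n).2.2.1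
    simp only [gradU_add, gradU_single, Pi.add_apply] at h1 h2 h3
    linarith
  have hτUX := hτs.pdX 0
  have hφUUU : ∀ z ∈ Ω, ∀ n m k l, pdU m (pdU k (pdU l (v.ver n))) z = 0 := by
    intro z hz n m k l
    rw [pdU_congr (Set.EqOn.eventuallyEq_of_mem (fun w hw => hφUU w hw n k l) (hΩ.mem_nhds hz)),
      (hτUX.pdU l).pdU_linear (hτUX.pdU k) _ _ m hz,
      hτs.pdU_pdU_pdX_eq_zero hΩ (fun w hw => hτUU w hw m l) 0 z hz,
      hτs.pdU_pdU_pdX_eq_zero hΩ (fun w hw => hτUU w hw m k) 0 z hz]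
    ring
  have hτU : ∀ z ∈ Ω, ∀ n, pdU n (v.hor 0) z = 0 := by
    intro z hz n
    obtain ⟨w, hw⟩ := hH.exists_dual Finset.univ n (Finset.mem_univ n)
    obtain ⟨b, hb⟩ := ((hφs n).pdX 0).pdU n |>.eventually_affine_line hΩ (fun y hy k l => by
      rw [pdU_congr (g := pdU l (pdX 0 (pdU n (v.ver n))))]
      · exact ((hφs n).pdU n).pdU_pdU_pdX_eq_zero hΩ (fun x hx => hφUUU x hx n k l n) 0 y hy
      · filter_upwards [hΩ.mem_nhds hy] with x hx
        refine pdU_congr ?_ l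
        filter_upwards [hΩ.mem_nhds hx] with x' hx'
        exact (hφs n).pdU_pdX_comm hx' n 0) hz w
    obtain ⟨c, hc⟩ := (hτUX.pdX 0).eventually_affine_line hΩ (fun y hy k l =>
      hτUX.pdU_pdU_pdX_eq_zero hΩ (hτs.pdU_pdU_pdX_eq_zero hΩ (fun x hx => hτUU x hx k l) 0)
        0 y hy) hz w
    have hP : ∀ᶠ s : ℝ in 𝓝 0, ∀ k ∈ (Finset.univ : Finset ι),
        pdU k (v.hor 0) (z + s • ((0, w) : Base 1 ι)) = pdU k (v.hor 0) z :=
      (Filter.eventually_all_finset _).2 fun k _ =>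
        (hτs.pdU k).eventually_const_line hΩ (fun y hy l => hτUU y hy l k) hz w
    -- Linear coefficient at `a = e_n`, along the direction dual to row `n`. The factor `3` counts
    -- `F_n ∂τ/∂u_n` once from `D_t²τ` and twice from `2 D_tτ`.
    have hkey : ∀ᶠ s : ℝ in 𝓝 0,
        (2 * pdU n (pdX 0 (v.ver n)) z - pdX 0 (pdX 0 (v.hor 0)) z
          - ∑ k ∈ Finset.univ.erase n, todaForce H k z.2 * pdU k (v.hor 0) z)
        + s * (2 * b - c)
        + Real.exp s * (-(3 * (todaForce H n z.2 * pdU n (v.hor 0) z)) + s * 0) = 0 := by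
      filter_upwards [hb, hc, hP, SmoothOn.eventually_line_mem hΩ hz (0, w)] with s h1 h2 h3 h4
      have hF : ∀ k, todaForce H k (z + s • ((0, w) : Base 1 ι)).2 =
          todaForce H k z.2 * if k = n then Real.exp s else 1 := by
        intro k
        rw [Prod.snd_add, Prod.smul_snd, todaForce_line hH.finite_row,
          exp_dual (hw k (Finset.mem_univ k))]
      have := (hsplit _ h4 (Pi.single n 1) n).2.1
      rw [gradU_single, gradU_single, h1, h2, h3 n (Finset.mem_univ n), hF, if_pos rfl, gradU,
        ← Finset.add_sum_erase _ _ (Finset.mem_univ n), hF, if_pos rfl, h3 n (Finset.mem_univ n),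
        Finset.sum_congr (g := fun k => todaForce H k z.2 * pdU k (v.hor 0) z) rfl
          fun k hk => by
            rw [hF, if_neg (Finset.ne_of_mem_erase hk), h3 k (Finset.mem_univ k), mul_one],
        Pi.single_eq_same] at this
      linarith
    have h3 := (eq_zero_of_affine_add_exp hkey).2.2.1
    exact (mul_eq_zero.1 (show todaForce H n z.2 * pdU n (v.hor 0) z = 0 by linarith)).resolve_left
      (todaForce_pos n z.2).ne'
  have hUU : ∀ z ∈ Ω, ∀ n k l, pdU k (pdU l (v.ver n)) z = 0 := by
    intro z hz n k l
    rw [hφUU z hz, hτs.pdU_pdX_eq_zero hΩ (fun w hw => hτU w hw l) 0 z hz,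
      hτs.pdU_pdX_eq_zero hΩ (fun w hw => hτU w hw k) 0 z hz]
    ring
  have key := separate_exponentials hH hΩ (A := fun n => pdX 0 (pdX 0 (v.ver n)))
    (σ := fun z => 2 * pdX 0 (v.hor 0) z) (φ := v.ver)
    (fun n => ((hφs n).pdX 0).pdX 0) (hτUX.const_mul 2) hφs
    (fun w hw n k l => ((hφs n).pdX 0).pdU_pdU_pdX_eq_zero hΩ
      ((hφs n).pdU_pdU_pdX_eq_zero hΩ (fun y hy => hUU y hy n k l) 0) 0 w hw)
    (fun w hw k => by
      have := hτUX.pdU_linear hτUX 2 0 k hw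
      simp only [zero_mul, add_zero] at this
      rw [this, hτs.pdU_pdX_eq_zero hΩ (fun y hy => hτU y hy k) 0 w hw, mul_zero])
    hUU (fun z hz n => by
      rw [finsum_eq_sum_of_fintype]
      exact (hsplit z hz 0 n).1)
  obtain ⟨n⟩ := ‹Nonempty ι›
  exact
    { smooth_hor := h.1
      smooth_ver := hφs
      pdU_hor := fun z hz a k => by
        rw [Subsingleton.elim a 0]
        exact hτU z hz k
      pdU_ver := fun z hz n k => (key z hz n).1 k
      pdX_pdX_hor := fun z hz => by
        -- Now that `τ` and `φ_n` do not depend on `u`, only `-τ_tt` survives in the linear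
        -- coefficient.
        have h1 := (hsplit z hz (Pi.single n 1) n).2.1
        rw [gradU_single, gradU_single, hτU z hz, gradU,
          Finset.sum_eq_zero fun k _ => by rw [hτU z hz, mul_zero],
          (hφs n).pdU_pdX_eq_zero hΩ (fun w hw => (key w hw n).1 n) 0 z hz,
          Pi.single_eq_same] at h1
        linarith
      pdX_pdX_ver := fun z hz n => (key z hz n).2.1
      balance := fun z hz n => (key z hz n).2.2 }

end Lattice

/-! ### From local to global -/

namespace SmoothOn

/-- `C` need not be open, so that it may be a slice with some `x_i` frozen. Nearby points of `C` are
joined by a segment in a convex neighbourhood inside `Ω`; the segment does not move the frozen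
coordinates, so `f` is locally constant on `C`. -/
theorem eq_of_isPreconnected [DecidableEq ι] {Ω C : Set (Base p ι)} {f : Base p ι → ℝ}
    (hf : SmoothOn Ω f) (hΩ : IsOpen Ω) (hC : IsPreconnected C) (hCΩ : C ⊆ Ω)
    (hX : ∀ i, (∀ z ∈ C, ∀ w ∈ C, z.1 i = w.1 i) ∨ ∀ w ∈ Ω, TodaSym.pdX i f w = 0)
    (hU : ∀ w ∈ Ω, ∀ k, TodaSym.pdU k f w = 0) {z w : Base p ι} (hz : z ∈ C) (hw : w ∈ C) :
    f z = f w := by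
  refine hC.induction₂ (fun a b => f a = f b) (fun a ha => ?_) (fun _ _ _ _ _ _ => Eq.trans)
    (fun _ _ _ _ => Eq.symm) hz hw
  obtain ⟨W, ⟨hW, hWc⟩, hWΩ⟩ :=
    (LocallyConvexSpace.convex_basis (𝕜 := ℝ) a).mem_iff.1 (hΩ.mem_nhds (hCΩ ha))
  filter_upwards [mem_nhdsWithin_of_mem_nhds hW, self_mem_nhdsWithin] with b hb hbC
  have hfW : SmoothOn W f := fun y hy => hf y (hWΩ hy)
  have := hfW.eq_of_segment (z := a) (d := b - a)
    (fun s hs => hWc.add_smul_sub_mem (mem_of_mem_nhds hW) hb hs)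
    (fun y hy i hi => (hX i).elim
      (fun h => absurd (by simp [h b hbC a ha]) hi) fun h => h y (hWΩ hy))
    (fun y hy => hU y (hWΩ hy))
  rw [← this, add_sub_cancel]

theorem eq_of_box [DecidableEq ι] {B : Fin p → Set ℝ} {U : Set (ι → ℝ)} {Ω : Set (Base p ι)}
    {f : Base p ι → ℝ} (hf : SmoothOn Ω f) (hΩ : IsOpen Ω) (hB : ∀ i, IsPreconnected (B i))
    (hUc : IsPreconnected U) (hBox : Ω = Set.univ.pi B ×ˢ U)
    (hU : ∀ w ∈ Ω, ∀ k, TodaSym.pdU k f w = 0) {z w : Base p ι} (hz : z ∈ Ω) (hw : w ∈ Ω)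
    (hX : ∀ i, z.1 i = w.1 i ∨ ∀ y ∈ Ω, TodaSym.pdX i f y = 0) : f z = f w := by
  classical
  have hz' : (∀ i, z.1 i ∈ B i) ∧ z.2 ∈ U := by
    rw [hBox] at hz; exact ⟨fun i => hz.1 i trivial, hz.2⟩
  have hw' : (∀ i, w.1 i ∈ B i) ∧ w.2 ∈ U := by
    rw [hBox] at hw; exact ⟨fun i => hw.1 i trivial, hw.2⟩
  -- Shrinking the factors where `z` and `w` agree to single points gives a connected slice through
  -- both, on which no derivative in those directions is needed.
  let B' : Fin p → Set ℝ := fun i => if z.1 i = w.1 i then {z.1 i} else B i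
  have hB' : ∀ i, IsPreconnected (B' i) := by
    intro i
    simp only [B']
    split_ifs
    exacts [isPreconnected_singleton, hB i]
  refine hf.eq_of_isPreconnected hΩ ((isPreconnected_univ_pi hB').prod hUc) ?_ ?_ hU ?_ ?_
  · rw [hBox]
    refine Set.prod_mono_left (Set.pi_mono fun i _ => ?_)
    simp only [B']
    split_ifs
    exacts [Set.singleton_subset_iff.2 (hz'.1 i), le_rfl]
  · intro i
    by_cases h : z.1 i = w.1 i
    · refine Or.inl fun a ha b hb => ?_
      have ha' := ha.1 i trivial
      have hb' := hb.1 i trivial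
      simp only [B', if_pos h, Set.mem_singleton_iff] at ha' hb'
      rw [ha', hb']
    · exact Or.inr ((hX i).resolve_left h)
  · refine ⟨fun i _ => ?_, hz'.2⟩
    simp only [B']
    split_ifs
    exacts [rfl, hz'.1 i]
  · refine ⟨fun i _ => ?_, hw'.2⟩
    simp only [B']
    split_ifs with h
    exacts [h.symm, hw'.1 i]

theorem pdX_linear {Ω : Set (Base p ι)} {f g : Base p ι → ℝ} (hf : SmoothOn Ω f)
    (hg : SmoothOn Ω g) (a b : ℝ) (i : Fin p) {z : Base p ι} (hz : z ∈ Ω) :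
    TodaSym.pdX i (fun w => a * f w + b * g w) z =
      a * TodaSym.pdX i f z + b * TodaSym.pdX i g z := by
  simp only [pdX_eq, hf.lineDeriv_linear hg a b _ hz]

end SmoothOn

theorem fieldDomain_eq (I J : Set ℝ) (U : Set (ι → ℝ)) :
    (fieldDomain I J U : Set (Base 2 ι)) = Set.univ.pi ![I, J] ×ˢ U := by
  ext z
  simp [fieldDomain, Set.mem_pi, Fin.forall_fin_two, and_assoc]

theorem latticeDomain_eq (I : Set ℝ) (U : Set (ι → ℝ)) :
    (latticeDomain I U : Set (Base 1 ι)) = Set.univ.pi ![I] ×ˢ U := by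
  ext z
  simp [latticeDomain, Set.mem_pi]

theorem isOpen_fieldDomain {I J : Set ℝ} {U : Set (ι → ℝ)} (hI : IsOpen I) (hJ : IsOpen J)
    (hU : IsOpen U) : IsOpen (fieldDomain I J U : Set (Base 2 ι)) := by
  rw [fieldDomain_eq]
  refine (isOpen_set_pi Set.finite_univ fun i _ => ?_).prod hU
  fin_cases i
  exacts [hI, hJ]

theorem isOpen_latticeDomain {I : Set ℝ} {U : Set (ι → ℝ)} (hI : IsOpen I)
    (hU : IsOpen U) : IsOpen (latticeDomain I U : Set (Base 1 ι)) := by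
  rw [latticeDomain_eq]
  refine (isOpen_set_pi Set.finite_univ fun i _ => ?_).prod hU
  fin_cases i
  exact hI

theorem FieldDetermining.congr [DecidableEq ι] {H : ι → ι → ℝ} {Ω : Set (Base 2 ι)}
    (hΩ : IsOpen Ω) {v w : PointField 2 ι} (hw : FieldDetermining H Ω w) (h : AgreeOn Ω v w) :
    FieldDetermining H Ω v := by
  have h1 : ∀ a, ∀ z ∈ Ω, v.hor a =ᶠ[𝓝 z] w.hor a := fun a z hz =>
    Set.EqOn.eventuallyEq_of_mem (fun y hy => (h y hy).1 a) (hΩ.mem_nhds hz)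
  have h2 : ∀ n, ∀ z ∈ Ω, v.ver n =ᶠ[𝓝 z] w.ver n := fun n z hz =>
    Set.EqOn.eventuallyEq_of_mem (fun y hy => (h y hy).2 n) (hΩ.mem_nhds hz)
  exact
    { smooth_hor := fun a => (hw.smooth_hor a).congr (h1 a)
      smooth_ver := fun n => (hw.smooth_ver n).congr (h2 n)
      pdX_hor_zero := fun z hz => (pdX_congr (h1 _ z hz) _).trans (hw.pdX_hor_zero z hz)
      pdX_hor_one := fun z hz => (pdX_congr (h1 _ z hz) _).trans (hw.pdX_hor_one z hz)
      pdU_hor := fun z hz a k => (pdU_congr (h1 _ z hz) _).trans (hw.pdU_hor z hz a k)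
      pdU_ver := fun z hz n k => (pdU_congr (h2 _ z hz) _).trans (hw.pdU_ver z hz n k)
      pdX_pdX_ver := fun z hz n => by
        rw [← hw.pdX_pdX_ver z hz n]
        refine pdX_congr ?_ _
        filter_upwards [hΩ.mem_nhds hz] with y hy
        exact pdX_congr (h2 n y hy) _
      balance := fun z hz n => by
        rw [← hw.balance z hz n, pdX_congr (h1 0 z hz), pdX_congr (h1 1 z hz)]
        simp only [(h z hz).2] }

theorem LatticeDetermining.congr [DecidableEq ι] {H : ι → ι → ℝ} {Ω : Set (Base 1 ι)}
    (hΩ : IsOpen Ω) {v w : PointField 1 ι} (hw : LatticeDetermining H Ω w) (h : AgreeOn Ω v w) :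
    LatticeDetermining H Ω v := by
  have h1 : ∀ a, ∀ z ∈ Ω, v.hor a =ᶠ[𝓝 z] w.hor a := fun a z hz =>
    Set.EqOn.eventuallyEq_of_mem (fun y hy => (h y hy).1 a) (hΩ.mem_nhds hz)
  have h2 : ∀ n, ∀ z ∈ Ω, v.ver n =ᶠ[𝓝 z] w.ver n := fun n z hz =>
    Set.EqOn.eventuallyEq_of_mem (fun y hy => (h y hy).2 n) (hΩ.mem_nhds hz)
  exact
    { smooth_hor := fun a => (hw.smooth_hor a).congr (h1 a)
      smooth_ver := fun n => (hw.smooth_ver n).congr (h2 n)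
      pdU_hor := fun z hz a k => (pdU_congr (h1 _ z hz) _).trans (hw.pdU_hor z hz a k)
      pdU_ver := fun z hz n k => (pdU_congr (h2 _ z hz) _).trans (hw.pdU_ver z hz n k)
      pdX_pdX_hor := fun z hz => by
        rw [← hw.pdX_pdX_hor z hz]
        refine pdX_congr ?_ _
        filter_upwards [hΩ.mem_nhds hz] with y hy
        exact pdX_congr (h1 0 y hy) _
      pdX_pdX_ver := fun z hz n => by
        rw [← hw.pdX_pdX_ver z hz n]
        refine pdX_congr ?_ _
        filter_upwards [hΩ.mem_nhds hz] with y hy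
        exact pdX_congr (h2 n y hy) _
      balance := fun z hz n => by
        rw [← hw.balance z hz n, pdX_congr (h1 0 z hz)]
        simp only [(h z hz).2] }

/-! ### Conformal fields and symmetries on product domains. -/

section Conformal

variable [DecidableEq ι] {I J : Set ℝ} {U : Set (ι → ℝ)}

/-- Only `Hc = -1` is needed of `c`, so the statement serves both the finite matrices and the
semi-infinite ones with continued coefficients. -/
theorem fieldDetermining_conformalField (hI : IsOpen I) (hJ : IsOpen J) {H : ι → ι → ℝ}
    {c : ι → ℝ} (hc : ∀ n, ∑ᶠ l, H n l * c l = -1) {ξ η : ℝ → ℝ} (hξ : ContDiffOn ℝ ∞ ξ I)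
    (hη : ContDiffOn ℝ ∞ η J) :
    FieldDetermining H (fieldDomain I J U) (conformalField c ξ η) := by
  have hξ' : ∀ z ∈ (fieldDomain I J U : Set (Base 2 ι)), ContDiffAt ℝ ∞ ξ (z.1 0) :=
    fun z hz => hξ.contDiffAt (hI.mem_nhds hz.1)
  have hη' : ∀ z ∈ (fieldDomain I J U : Set (Base 2 ι)), ContDiffAt ℝ ∞ η (z.1 1) :=
    fun z hz => hη.contDiffAt (hJ.mem_nhds hz.2.1)
  have hproj : ∀ (i : Fin 2) (x : Fin 2 → ℝ), ContDiffAt ℝ ∞ (fun x : Fin 2 → ℝ => x i) x :=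
    fun i x => (contDiff_apply ℝ ℝ i).contDiffAt
  have hderiv : ∀ {f : ℝ → ℝ} {t : ℝ}, ContDiffAt ℝ ∞ f t → ContDiffAt ℝ ∞ (deriv f) t :=
    fun {f t} h => by
      have := contDiffAt_fderiv_apply h (1 : ℝ)
      simpa only [fderiv_apply_one_eq_deriv] using this
  have hσ : ∀ z : Base 2 ι, pdX 0 ((conformalField c ξ η).hor 0) z
      + pdX 1 ((conformalField c ξ η).hor 1) z = deriv ξ (z.1 0) + deriv η (z.1 1) := by
    intro z
    simp [pdX, conformalField]
  refine ⟨fun a => ?_, fun n => ?_, fun z _ => ?_, fun z _ => ?_, fun z _ a k => ?_,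
    fun z _ n k => ?_, fun z _ n => ?_, fun z _ n => ?_⟩
  · fin_cases a
    · exact SmoothOn.of_base (h := fun x => ξ (x 0)) fun z hz =>
        ContDiffAt.comp (g := ξ) (f := fun x : Fin 2 → ℝ => x 0) _ (hξ' z hz) (hproj 0 _)
    · exact SmoothOn.of_base (h := fun x => η (x 1)) fun z hz =>
        ContDiffAt.comp (g := η) (f := fun x : Fin 2 → ℝ => x 1) _ (hη' z hz) (hproj 1 _)
  · exact SmoothOn.of_base (h := fun x => (deriv ξ (x 0) + deriv η (x 1)) * c n) fun z hz =>
      ((ContDiffAt.comp (g := deriv ξ) (f := fun x : Fin 2 → ℝ => x 0) _ (hderiv (hξ' z hz))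
        (hproj 0 _)).add
      (ContDiffAt.comp (g := deriv η) (f := fun x : Fin 2 → ℝ => x 1) _ (hderiv (hη' z hz))
        (hproj 1 _))).mul contDiffAt_const
  · simp [pdX, conformalField]
  · simp [pdX, conformalField]
  · fin_cases a <;> simp [pdU, conformalField]
  · simp [pdU, conformalField]
  · simp [pdX, conformalField]
  · rw [hσ]
    have : ∀ l, H n l * (conformalField c ξ η).ver l z =
        (deriv ξ (z.1 0) + deriv η (z.1 1)) * (H n l * c l) := fun l => by
      simp only [conformalField]; ring
    rw [finsum_congr this, ← mul_finsum, hc]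
    ring

/-- On a product domain the horizontal part of a symmetry is `ξ(x)∂_x + η(y)∂_y`. -/
theorem FieldDetermining.exists_conformal {H : ι → ι → ℝ} {v : PointField 2 ι}
    (hI : IsOpen I) (hIc : IsConnected I) (hJ : IsOpen J) (hJc : IsConnected J)
    (hU : IsOpen U) (hUc : IsConnected U) (h : FieldDetermining H (fieldDomain I J U) v) :
    ∃ ξ η : ℝ → ℝ, ContDiffOn ℝ ∞ ξ I ∧ ContDiffOn ℝ ∞ η J ∧
      ∀ z ∈ fieldDomain I J U, v.hor 0 z = ξ (z.1 0) ∧ v.hor 1 z = η (z.1 1) ∧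
        pdX 0 (v.hor 0) z = deriv ξ (z.1 0) ∧ pdX 1 (v.hor 1) z = deriv η (z.1 1) := by
  have hΩ := isOpen_fieldDomain hI hJ hU
  obtain ⟨x₀, hx₀⟩ := hIc.nonempty
  obtain ⟨y₀, hy₀⟩ := hJc.nonempty
  obtain ⟨u₀, hu₀⟩ := hUc.nonempty
  have hB : ∀ i, IsPreconnected ((![I, J] : Fin 2 → Set ℝ) i) := by
    intro i
    fin_cases i
    exacts [hIc.isPreconnected, hJc.isPreconnected]
  have hξ : ∀ z ∈ fieldDomain I J U, v.hor 0 z = v.hor 0 (![z.1 0, y₀], u₀) := by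
    intro z hz
    refine (h.smooth_hor 0).eq_of_box hΩ hB hUc.isPreconnected (fieldDomain_eq I J U)
      (fun w hw k => h.pdU_hor w hw 0 k) hz ⟨hz.1, hy₀, hu₀⟩ fun i => ?_
    fin_cases i
    exacts [Or.inl rfl, Or.inr h.pdX_hor_zero]
  have hη : ∀ z ∈ fieldDomain I J U, v.hor 1 z = v.hor 1 (![x₀, z.1 1], u₀) := by
    intro z hz
    refine (h.smooth_hor 1).eq_of_box hΩ hB hUc.isPreconnected (fieldDomain_eq I J U)
      (fun w hw k => h.pdU_hor w hw 1 k) hz ⟨hx₀, hz.2.1, hu₀⟩ fun i => ?_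
    fin_cases i
    exacts [Or.inr h.pdX_hor_one, Or.inl rfl]
  have hc0 : ContDiff ℝ ∞ fun x : ℝ => ![x, y₀] := by
    refine contDiff_pi.2 fun i => ?_
    fin_cases i
    exacts [contDiff_id, contDiff_const]
  have hc1 : ContDiff ℝ ∞ fun y : ℝ => ![x₀, y] := by
    refine contDiff_pi.2 fun i => ?_
    fin_cases i
    exacts [contDiff_const, contDiff_id]
  -- The values outside `I` and `J` are irrelevant: the intervals are open, so derivatives at their
  -- points see only the inside.
  refine ⟨fun x => v.hor 0 (![x, y₀], u₀), fun y => v.hor 1 (![x₀, y], u₀), fun x hx => ?_,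
    fun y hy => ?_, fun z hz => ⟨hξ z hz, hη z hz, ?_, ?_⟩⟩
  · have := (h.smooth_hor 0).contDiffAt_base (x := ![x, y₀]) (u := u₀) ⟨hx, hy₀, hu₀⟩
    exact (ContDiffAt.comp (f := fun x : ℝ => ![x, y₀]) x this hc0.contDiffAt).contDiffWithinAt
  · have := (h.smooth_hor 1).contDiffAt_base (x := ![x₀, y]) (u := u₀) ⟨hx₀, hy, hu₀⟩
    exact (ContDiffAt.comp (f := fun y : ℝ => ![x₀, y]) y this hc1.contDiffAt).contDiffWithinAt
  · refine Filter.EventuallyEq.deriv_eq ?_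
    filter_upwards [hI.mem_nhds hz.1] with s hs
    rw [hξ (Function.update z.1 0 s, z.2) ⟨by simpa using hs, by simpa using hz.2.1, hz.2.2⟩]
    simp
  · refine Filter.EventuallyEq.deriv_eq ?_
    filter_upwards [hJ.mem_nhds hz.2.1] with s hs
    rw [hη (Function.update z.1 1 s, z.2) ⟨by simpa using hz.1, by simpa using hs, hz.2.2⟩]
    simp

/-- On a product domain the vertical part of a symmetry does not depend on `u`. -/
theorem FieldDetermining.ver_eq {H : ι → ι → ℝ} {v : PointField 2 ι}
    (hI : IsOpen I) (hIc : IsConnected I) (hJ : IsOpen J) (hJc : IsConnected J)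
    (hU : IsOpen U) (hUc : IsConnected U) (h : FieldDetermining H (fieldDomain I J U) v)
    {x : Fin 2 → ℝ} {u u' : ι → ℝ} (hu : (x, u) ∈ fieldDomain I J U)
    (hu' : (x, u') ∈ fieldDomain I J U) (n : ι) : v.ver n (x, u) = v.ver n (x, u') := by
  refine (h.smooth_ver n).eq_of_box (isOpen_fieldDomain hI hJ hU) (B := ![I, J]) (fun i => ?_)
    hUc.isPreconnected (fieldDomain_eq I J U) (fun w hw k => h.pdU_ver w hw n k) hu hu'
    fun i => Or.inl rfl
  fin_cases i
  exacts [hIc.isPreconnected, hJc.isPreconnected]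

end Conformal

/-! ### The finite theories -/

theorem eq_mul_finiteCoeff (s : Series) {N : ℕ} (hN : s.minRank ≤ N) {w : Fin N → ℝ} {σ : ℝ}
    (hw : ∀ n, ∑ᶠ l, finiteH s N n l * w l + σ = 0) (n : Fin N) : w n = σ * finiteCoeff s N n := by
  have : (fun l => w l - σ * finiteCoeff s N l) = 0 := by
    refine finiteH_injective s hN fun i => ?_
    have h1 := hw i
    have h2 := sum_finiteH_finiteCoeff s hN i
    rw [finsum_eq_sum_of_fintype] at h1
    have : ∑ j, finiteH s N i j * (w j - σ * finiteCoeff s N j) =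
        ∑ j, finiteH s N i j * w j - σ * ∑ j, finiteH s N i j * finiteCoeff s N j := by
      rw [Finset.mul_sum, ← Finset.sum_sub_distrib]
      exact Finset.sum_congr rfl fun j _ => by ring
    rw [this, h2]
    linarith
  exact sub_eq_zero.1 (congrFun this n)

theorem Series.nonempty_fin (s : Series) {N : ℕ} (hN : s.minRank ≤ N) : Nonempty (Fin N) := by
  refine ⟨⟨0, ?_⟩⟩
  cases s <;> simp only [Series.minRank] at hN <;> omega

section Finite

variable {s : Series} {N : ℕ} {I J : Set ℝ} {U : Set (Fin N → ℝ)}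

theorem isFieldSymmetry_finite_iff (hN : s.minRank ≤ N) (hI : IsOpen I) (hIc : IsConnected I)
    (hJ : IsOpen J) (hJc : IsConnected J) (hU : IsOpen U) (hUc : IsConnected U)
    (v : PointField 2 (Fin N)) :
    IsFieldSymmetry (finiteH s N) (fieldDomain I J U) v ↔
      ∃ ξ η : ℝ → ℝ, ContDiffOn ℝ ∞ ξ I ∧ ContDiffOn ℝ ∞ η J ∧
        AgreeOn (fieldDomain I J U) v (conformalField (finiteCoeff s N) ξ η) := by
  have hΩ := isOpen_fieldDomain hI hJ hU
  have := s.nonempty_fin hN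
  have hH := rowIndependent_finiteH s hN
  constructor
  · intro hv
    have h := hv.fieldDetermining hH hΩ
    obtain ⟨ξ, η, hξ, hη, hh⟩ := h.exists_conformal hI hIc hJ hJc hU hUc
    refine ⟨ξ, η, hξ, hη, fun z hz => ?_⟩
    obtain ⟨h0, h1, h2, h3⟩ := hh z hz
    constructor
    · intro a
      fin_cases a
      exacts [h0, h1]
    · intro n
      rw [eq_mul_finiteCoeff s hN (h.balance z hz) n, h2, h3]
      rfl
  · rintro ⟨ξ, η, hξ, hη, hv⟩
    refine FieldDetermining.isFieldSymmetry hH.finite_row hΩ (FieldDetermining.congr hΩ ?_ hv)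
    refine fieldDetermining_conformalField hI hJ (fun n => ?_) hξ hη
    rw [finsum_eq_sum_of_fintype, sum_finiteH_finiteCoeff s hN]

theorem inheritedFromSemi_of_conformal (hI : IsOpen I) (hJ : IsOpen J)
    {v : PointField 2 (Fin N)} {ξ η : ℝ → ℝ} (hξ : ContDiffOn ℝ ∞ ξ I) (hη : ContDiffOn ℝ ∞ η J)
    (hv : AgreeOn (fieldDomain I J U) v (conformalField (finiteCoeff s N) ξ η)) :
    InheritedFromSemi s N I J U v := by
  -- The same `ξ`, `η` and the same formula for the coefficients, with `N` kept as a parameter and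
  -- the label unrestricted.
  refine ⟨conformalField (fun l : ℕ => conformalCoeff N ((l : ℝ) + 1) s) ξ η, ?_, fun z hz => ?_⟩
  · exact (fieldDetermining_conformalField hI hJ (finsum_semiH_conformalCoeff s N) hξ
      hη).isFieldSymmetry (finite_support_semiH s) (isOpen_fieldDomain hI hJ isOpen_univ)
  · refine ⟨fun a => ?_, fun n => (hv z hz).2 n⟩
    rw [(hv z hz).1 a]
    fin_cases a <;> rfl

theorem isLatticeSymmetry_finite_iff (hN : s.minRank ≤ N) (hI : IsOpen I) (hIc : IsConnected I)
    (hU : IsOpen U) (hUc : IsConnected U) (v : PointField 1 (Fin N)) :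
    IsLatticeSymmetry (finiteH s N) (latticeDomain I U) v ↔
      ∃ α β : ℝ, AgreeOn (latticeDomain I U) v
        (translationDilation (finiteCoeff s N) α β) := by
  have hΩ := isOpen_latticeDomain hI hU
  have := s.nonempty_fin hN
  have hH := rowIndependent_finiteH s hN
  have hlin : ∀ α β : ℝ, ∀ z : Base 1 (Fin N), pdX 0 (fun w => α + β * w.1 0) z = β := by
    intro α β z
    simp [pdX, deriv_const_mul_id']
  have hB : ∀ i, IsPreconnected ((![I] : Fin 1 → Set ℝ) i) := by
    intro i
    fin_cases i
    exact hIc.isPreconnected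
  have hcoord : SmoothOn (latticeDomain I U) fun z : Base 1 (Fin N) => z.1 0 :=
    SmoothOn.of_base (h := fun x => x 0) fun z _ => (contDiff_apply ℝ ℝ 0).contDiffAt
  constructor
  · intro hv
    have h := hv.latticeDetermining hH hΩ
    obtain ⟨t₀, ht₀⟩ := hIc.nonempty
    obtain ⟨u₀, hu₀⟩ := hUc.nonempty
    set z₀ : Base 1 (Fin N) := (fun _ => t₀, u₀) with hz₀
    have hz₀m : z₀ ∈ latticeDomain I U := ⟨ht₀, hu₀⟩
    set β := pdX 0 (v.hor 0) z₀ with hβ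
    have h1 : ∀ z ∈ latticeDomain I U, pdX 0 (v.hor 0) z = β := fun z hz =>
      ((h.smooth_hor 0).pdX 0).eq_of_box hΩ hB hUc.isPreconnected (latticeDomain_eq I U)
        (fun w hw k => (h.smooth_hor 0).pdU_pdX_eq_zero hΩ (fun y hy => h.pdU_hor y hy 0 k) 0 w hw)
        hz hz₀m fun i => Or.inr (by rw [Subsingleton.elim i 0]; exact h.pdX_pdX_hor)
    -- `τ - βt` has zero derivatives, hence is constant; it is written as a linear combination to
    -- fit `pdU_linear` and `pdX_linear`.
    have h2 : ∀ z ∈ latticeDomain I U, 1 * v.hor 0 z + -β * z.1 0 =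
        1 * v.hor 0 z₀ + -β * z₀.1 0 := by
      have hcU : ∀ (k : Fin N) (w : Base 1 (Fin N)), pdU k (fun z => z.1 0) w = 0 := by
        intro k w
        simp [pdU]
      have hcX : ∀ w : Base 1 (Fin N), pdX 0 (fun z => z.1 0) w = 1 := by
        intro w
        simp [pdX]
      intro z hz
      refine SmoothOn.eq_of_box (f := fun z : Base 1 (Fin N) => 1 * v.hor 0 z + -β * z.1 0)
        (((h.smooth_hor 0).const_mul 1).add (hcoord.const_mul (-β))) hΩ hB hUc.isPreconnected
        (latticeDomain_eq I U) (fun w hw k => ?_) hz hz₀m fun i => Or.inr fun w hw => ?_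
      · rw [(h.smooth_hor 0).pdU_linear hcoord _ _ _ hw, h.pdU_hor w hw, hcU]
        ring
      · rw [Subsingleton.elim i 0, (h.smooth_hor 0).pdX_linear hcoord _ _ _ hw, h1 w hw, hcX]
        ring
    refine ⟨v.hor 0 z₀ - β * z₀.1 0, β, fun z hz => ⟨fun a => ?_, fun n => ?_⟩⟩
    · rw [Subsingleton.elim a 0]
      have := h2 z hz
      simp only [translationDilation]
      linarith
    · rw [eq_mul_finiteCoeff s hN (h.balance z hz) n, h1 z hz]
      simp only [translationDilation]
      ring
  · rintro ⟨α, β, hv⟩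
    refine LatticeDetermining.isLatticeSymmetry hH.finite_row hΩ (LatticeDetermining.congr hΩ ?_ hv)
    have hX : pdX 0 ((translationDilation (finiteCoeff s N) α β).hor 0) = fun _ => β :=
      funext fun z => hlin α β z
    refine ⟨fun a => ?_, fun n => ?_, fun z _ a k => ?_, fun z _ n k => ?_, fun z _ => ?_,
      fun z _ n => ?_, fun z _ n => ?_⟩
    · exact SmoothOn.of_base (h := fun x => α + β * x 0) fun z _ =>
        contDiffAt_const.add (contDiffAt_const.mul (contDiff_apply ℝ ℝ 0).contDiffAt)
    · exact SmoothOn.of_base (h := fun _ => β * (2 * finiteCoeff s N n)) fun z _ => contDiffAt_const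
    · simp [pdU, translationDilation]
    · simp [pdU, translationDilation]
    · rw [hX, pdX_const]
    · simp [pdX, translationDilation]
    · rw [hX, finsum_eq_sum_of_fintype]
      have : ∀ l, finiteH s N n l * (translationDilation (finiteCoeff s N) α β).ver l z =
          2 * β * (finiteH s N n l * finiteCoeff s N l) := fun l => by
        simp only [translationDilation]; ring
      rw [Finset.sum_congr rfl fun l _ => this l, ← Finset.mul_sum,
        sum_finiteH_finiteCoeff s hN]
      ring

end Finite

/-! ### The semi-infinite theories -/

section Semi

variable {I J : Set ℝ}

/-- If the solution of the homogeneous recursion determined by the first row is a combination of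
its first two terms that continues to all integers, the symmetries are inherited. -/
theorem inheritedFromInfinite_of_coeff {s : Series} (hs : s.regularRow = 1) {α β : ℤ → ℝ}
    (hα₁ : α 1 = 1) (hβ₁ : β 1 = 0) (hα₂ : α 2 = 0) (hβ₂ : β 2 = 1) {a b : ℝ}
    (hα : ∀ n, -α (n - 1) + 2 * α n - α (n + 1) = a)
    (hβ : ∀ n, -β (n - 1) + 2 * β n - β (n + 1) = b)
    (hrow : ∀ q : ℕ → ℝ, ∑ᶠ l, semiH s 0 l * q l = a * q 0 + b * q 1)
    (hI : IsOpen I) (hIc : IsConnected I) (hJ : IsOpen J) (hJc : IsConnected J)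
    {v : PointField 2 ℕ} (hv : IsFieldSymmetry (semiH s) (fieldDomain I J Set.univ) v) :
    InheritedFromInfinite I J v := by
  have h := hv.fieldDetermining (rowIndependent_semiH s) (isOpen_fieldDomain hI hJ isOpen_univ)
  have hmem : ∀ {z : Base 2 ℤ}, z ∈ fieldDomain I J Set.univ →
      (z.1, (0 : ℕ → ℝ)) ∈ fieldDomain I J Set.univ := fun hz => ⟨hz.1, hz.2.1, trivial⟩
  have hq : ∀ m, SmoothOn (fieldDomain I J Set.univ) fun z : Base 2 ℤ => v.ver m (z.1, 0) :=
    fun m => SmoothOn.of_base (h := fun x => v.ver m (x, 0)) fun z hz =>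
      (h.smooth_ver m).contDiffAt_base (hmem hz)
  -- The balance equations express every `φ_n` through the first two. The same expressions, taken at
  -- `u = 0`, define the field at nonpositive labels; index `0` is label `1`.
  let V : PointField 2 ℤ :=
    { hor := fun i z => v.hor i (z.1, 0)
      ver := fun n z => α n * v.ver 0 (z.1, 0) + β n * v.ver 1 (z.1, 0) }
  have hV : FieldDetermining infiniteH (fieldDomain I J Set.univ) V := by
    refine ⟨fun i => ?_, fun n => ?_, fun z hz => ?_, fun z hz => ?_, fun z _ i k => ?_,
      fun z _ n k => ?_, fun z hz n => ?_, fun z hz n => ?_⟩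
    · exact SmoothOn.of_base (h := fun x => v.hor i (x, 0)) fun z hz =>
        (h.smooth_hor i).contDiffAt_base (hmem hz)
    · exact ((hq 0).const_mul _).add ((hq 1).const_mul _)
    · exact h.pdX_hor_zero _ (hmem hz)
    · exact h.pdX_hor_one _ (hmem hz)
    · simp [pdU, V]
    · simp [pdU, V]
    · have hΩ : IsOpen (fieldDomain I J Set.univ : Set (Base 2 ℤ)) :=
        isOpen_fieldDomain hI hJ isOpen_univ
      rw [pdX_congr (Set.EqOn.eventuallyEq_of_mem
        (fun w hw => (hq 0).pdX_linear (hq 1) (α n) (β n) 1 hw) (hΩ.mem_nhds hz)),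
        ((hq 0).pdX 1).pdX_linear ((hq 1).pdX 1) _ _ _ hz]
      have h0 := h.pdX_pdX_ver _ (hmem hz) 0
      have h1 := h.pdX_pdX_ver _ (hmem hz) 1
      change α n * pdX 0 (pdX 1 (v.ver 0)) (z.1, 0) + β n * pdX 0 (pdX 1 (v.ver 1)) (z.1, 0) = 0
      rw [h0, h1]
      ring
    -- Each row of the infinite matrix maps the continued sequence to `a φ_1 + b φ_2`, which the
    -- first semi-infinite row identifies with `-(ξ_x + η_y)`.
    · have h0 := h.balance _ (hmem hz) 0
      rw [hrow] at h0
      rw [finsum_infiniteH]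
      change _ + (pdX 0 (v.hor 0) (z.1, 0) + pdX 1 (v.hor 1) (z.1, 0)) = 0
      simp only [V]
      rw [← h0, ← hα n, ← hβ n]
      ring
  refine ⟨V, hV.isFieldSymmetry rowIndependent_infiniteH.finite_row
    (isOpen_fieldDomain hI hJ isOpen_univ), fun z hz => ?_⟩
  have hz0 : (z.1, (0 : ℕ → ℝ)) ∈ fieldDomain I J Set.univ := ⟨hz.1, hz.2.1, trivial⟩
  constructor
  · intro i
    obtain ⟨ξ, η, -, -, hh⟩ := h.exists_conformal hI hIc hJ hJc isOpen_univ isConnected_univ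
    change v.hor i z = v.hor i (z.1, 0)
    fin_cases i
    · exact (hh z hz).1.trans (hh _ hz0).1.symm
    · exact (hh z hz).2.1.trans (hh _ hz0).2.1.symm
  · intro n
    change v.ver n z = α (n + 1) * v.ver 0 (z.1, 0) + β (n + 1) * v.ver 1 (z.1, 0)
    rw [h.ver_eq hI hIc hJ hJc isOpen_univ isConnected_univ (x := z.1) (u := z.2) hz hz0 n]
    have h0 := h.balance _ hz0 0
    rw [hrow] at h0
    induction n using Nat.twoStepInduction with
    | zero => simp [hα₁, hβ₁]
    | one => norm_num [hα₂, hβ₂]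
    | more n ih0 ih1 =>
      have h1 := h.balance _ hz0 (n + 1)
      rw [finsum_semiH_regular (by omega)] at h1
      have hα' := hα (n + 2)
      have hβ' := hβ (n + 2)
      push_cast at ih0 ih1 ⊢
      rw [show (n : ℤ) + 2 - 1 = n + 1 by ring, show (n : ℤ) + 2 + 1 = n + 2 + 1 by ring]
        at hα' hβ'
      rw [show (n : ℤ) + 1 + 1 = n + 2 by ring] at ih1
      linear_combination (-1 : ℝ) * h1 + h0 - ih0 + 2 * ih1 +
        v.ver 0 (z.1, 0) * hα' + v.ver 1 (z.1, 0) * hβ'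

theorem inheritedFromInfinite_A (hI : IsOpen I) (hIc : IsConnected I) (hJ : IsOpen J)
    (hJc : IsConnected J) {v : PointField 2 ℕ}
    (hv : IsFieldSymmetry (semiH .A) (fieldDomain I J Set.univ) v) :
    InheritedFromInfinite I J v := by
  -- The quadratics with second differences `-2` and `1` and the prescribed values at `1` and `2`;
  -- both vanish at the virtual node `0`.
  refine inheritedFromInfinite_of_coeff (s := .A) rfl (α := fun n => 2 * n - n ^ 2)
    (β := fun n => n * (n - 1) / 2) ?_ ?_ ?_ ?_ (a := 2) (b := -1) ?_ ?_ ?_ hI hIc hJ hJc hv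
  · norm_num
  · norm_num
  · norm_num
  · norm_num
  · intro n; push_cast; ring
  · intro n; push_cast; ring
  · intro q; rw [finsum_semiH_A_zero]; ring

theorem inheritedFromInfinite_C (hI : IsOpen I) (hIc : IsConnected I) (hJ : IsOpen J)
    (hJc : IsConnected J) {v : PointField 2 ℕ}
    (hv : IsFieldSymmetry (semiH .C) (fieldDomain I J Set.univ) v) :
    InheritedFromInfinite I J v := by
  -- Here the second differences are `-2` and `2`, and both quadratics are even about `n = 1`, which
  -- is the reflection condition `q_0 = q_2`.
  refine inheritedFromInfinite_of_coeff (s := .C) rfl (α := fun n => 1 - (n - 1) ^ 2)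
    (β := fun n => (n - 1) ^ 2) ?_ ?_ ?_ ?_ (a := 2) (b := -2) ?_ ?_ ?_ hI hIc hJ hJc hv
  · norm_num
  · norm_num
  · norm_num
  · norm_num
  · intro n; push_cast; ring
  · intro n; push_cast; ring
  · intro q; rw [finsum_semiH_C_zero]; ring

/-- A constant vertical symmetry is not inherited unless it is affine in the label. -/
theorem exists_not_inherited {s : Series} {k : ℕ → ℝ} (hk : ∀ n, ∑ᶠ l, semiH s n l * k l = 0)
    (hk' : -k 0 + 2 * k 1 - k 2 ≠ 0) (hI : IsOpen I) (hIc : IsConnected I)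
    (hJ : IsOpen J) (hJc : IsConnected J) :
    ∃ v : PointField 2 ℕ, IsFieldSymmetry (semiH s) (fieldDomain I J Set.univ) v ∧
      ¬ InheritedFromInfinite I J v := by
  let v : PointField 2 ℕ := { hor := fun _ _ => 0, ver := fun n _ => k n }
  have hv : FieldDetermining (semiH s) (fieldDomain I J Set.univ) v := by
    refine ⟨fun _ => ?_, fun n => ?_, fun z _ => ?_, fun z _ => ?_, fun z _ _ l => ?_,
      fun z _ n l => ?_, fun z _ n => ?_, fun z _ n => ?_⟩
    · exact SmoothOn.of_base (h := fun _ => 0) fun _ _ => contDiffAt_const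
    · exact SmoothOn.of_base (h := fun _ => k n) fun _ _ => contDiffAt_const
    · exact pdX_const _ _ _
    · exact pdX_const _ _ _
    · exact pdU_const _ _ _
    · exact pdU_const _ _ _
    · simp [pdX, v]
    · simp only [v, pdX_const, hk, add_zero]
  refine ⟨v, hv.isFieldSymmetry (finite_support_semiH s)
    (isOpen_fieldDomain hI hJ isOpen_univ), ?_⟩
  rintro ⟨V, hV, htr⟩
  have h := hV.fieldDetermining rowIndependent_infiniteH
    (isOpen_fieldDomain hI hJ isOpen_univ)
  obtain ⟨x₀, hx₀⟩ := hIc.nonempty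
  obtain ⟨y₀, hy₀⟩ := hJc.nonempty
  set w : ℤ → ℝ := Function.extend (fun i : ℕ => (i : ℤ) + 1) 0 0
  have hhor : ∀ x : Fin 2 → ℝ, x 0 ∈ I → x 1 ∈ J → ∀ a, V.hor a (x, w) = 0 :=
    fun x h0 h1 a => ((htr (x, 0) ⟨h0, h1, trivial⟩).1 a).symm
  have hver : ∀ n : ℕ, V.ver (n + 1) (![x₀, y₀], w) = k n :=
    fun n => ((htr (![x₀, y₀], 0) ⟨hx₀, hy₀, trivial⟩).2 n).symm
  -- Label `2` is the first whose row involves only labels `1, 2, 3` kept by the truncation. The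
  -- horizontal part vanishes for all `x`, `y` at `u = w`, so its derivatives drop out and the
  -- second difference of `k` would be zero.
  have hb := h.balance (![x₀, y₀], w) ⟨hx₀, hy₀, trivial⟩ 2
  have hX : pdX 0 (V.hor 0) (![x₀, y₀], w) = 0 := by
    refine (Filter.EventuallyEq.deriv_eq (f := fun _ => (0 : ℝ)) ?_).trans (deriv_const _ _)
    filter_upwards [hI.mem_nhds hx₀] with t ht
    exact hhor _ (by simpa using ht) (by simpa using hy₀) 0
  have hY : pdX 1 (V.hor 1) (![x₀, y₀], w) = 0 := by
    refine (Filter.EventuallyEq.deriv_eq (f := fun _ => (0 : ℝ)) ?_).trans (deriv_const _ _)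
    filter_upwards [hJ.mem_nhds hy₀] with t ht
    exact hhor _ (by simpa using hx₀) (by simpa using ht) 1
  have h0 := hver 0
  have h1 := hver 1
  have h2 := hver 2
  norm_num at h0 h1 h2
  rw [finsum_infiniteH, hX, hY] at hb
  norm_num [h0, h1, h2] at hb
  exact hk' hb

theorem exists_not_inherited_B (hI : IsOpen I) (hIc : IsConnected I)
    (hJ : IsOpen J) (hJc : IsConnected J) :
    ∃ v : PointField 2 ℕ, IsFieldSymmetry (semiH .B) (fieldDomain I J Set.univ) v ∧
      ¬ InheritedFromInfinite I J v := by
  -- The kernel vector `(1, 2, 2, …)`: the double bond lets the first entry be half of the others.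
  refine exists_not_inherited (k := fun n => if n = 0 then 1 else 2) (fun n => ?_) (by norm_num)
    hI hIc hJ hJc
  rcases n with _ | _ | n
  · rw [finsum_semiH_B_zero]; norm_num
  · rw [finsum_semiH_B_one]; norm_num
  · rw [finsum_semiH_regular (by simp [Series.regularRow])]; norm_num

theorem exists_not_inherited_D (hI : IsOpen I) (hIc : IsConnected I)
    (hJ : IsOpen J) (hJc : IsConnected J) :
    ∃ v : PointField 2 ℕ, IsFieldSymmetry (semiH .D) (fieldDomain I J Set.univ) v ∧
      ¬ InheritedFromInfinite I J v := by
  -- The kernel vector `(1, 1, 2, 2, …)`: the two ends of the fork share the weight of one node.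
  refine exists_not_inherited (k := fun n => if n ≤ 1 then 1 else 2) (fun n => ?_) (by norm_num)
    hI hIc hJ hJc
  rcases n with _ | _ | _ | n
  · rw [finsum_semiH_D_zero]; norm_num
  · rw [finsum_semiH_D_one]; norm_num
  · rw [finsum_semiH_D_two]; norm_num
  · rw [finsum_semiH_regular (by simp [Series.regularRow]), if_neg (by omega), if_neg (by omega),
      if_neg (by omega)]
    norm_num

end Semi

end TodaSym

end

theorem theorem4 :
    (∀ (s : TodaSym.Series) (N : ℕ), s.minRank ≤ N →
      ∀ I J : Set ℝ, IsOpen I → IsConnected I → IsOpen J → IsConnected J →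
      ∀ U : Set (Fin N → ℝ), IsOpen U → IsConnected U →
        -- the symmetries of the finite field theory are exactly the conformal fields
        (∀ v : TodaSym.PointField 2 (Fin N),
          TodaSym.IsFieldSymmetry (TodaSym.finiteH s N) (TodaSym.fieldDomain I J U) v ↔
            ∃ ξ η : ℝ → ℝ, ContDiffOn ℝ ∞ ξ I ∧ ContDiffOn ℝ ∞ η J ∧
              TodaSym.AgreeOn (TodaSym.fieldDomain I J U) v
                (TodaSym.conformalField (TodaSym.finiteCoeff s N) ξ η)) ∧
        -- they are all inherited from the semi-infinite theory
        (∀ v : TodaSym.PointField 2 (Fin N),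
          TodaSym.IsFieldSymmetry (TodaSym.finiteH s N) (TodaSym.fieldDomain I J U) v →
            TodaSym.InheritedFromSemi s N I J U v) ∧
        -- the symmetries of the finite lattice are exactly the span of a translation and a dilation
        (∀ v : TodaSym.PointField 1 (Fin N),
          TodaSym.IsLatticeSymmetry (TodaSym.finiteH s N) (TodaSym.latticeDomain I U) v ↔
            ∃ α β : ℝ, TodaSym.AgreeOn (TodaSym.latticeDomain I U) v
              (TodaSym.translationDilation (TodaSym.finiteCoeff s N) α β))) ∧
    (∀ I J : Set ℝ, IsOpen I → IsConnected I → IsOpen J → IsConnected J →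
      -- for `A` and `C`, the semi-infinite symmetries are all inherited from the infinite theory
      (∀ s : TodaSym.Series, s = .A ∨ s = .C → ∀ v : TodaSym.PointField 2 ℕ,
        TodaSym.IsFieldSymmetry (TodaSym.semiH s) (TodaSym.fieldDomain I J Set.univ) v →
          TodaSym.InheritedFromInfinite I J v) ∧
      -- for `B` and `D`, they are not
      (∀ s : TodaSym.Series, s = .B ∨ s = .D → ∃ v : TodaSym.PointField 2 ℕ,
        TodaSym.IsFieldSymmetry (TodaSym.semiH s) (TodaSym.fieldDomain I J Set.univ) v ∧
          ¬ TodaSym.InheritedFromInfinite I J v)) := by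
  refine ⟨fun s N hN I J hI hIc hJ hJc U hU hUc => ⟨?_, ?_, ?_⟩,
    fun I J hI hIc hJ hJc => ⟨?_, ?_⟩⟩
  · exact TodaSym.isFieldSymmetry_finite_iff hN hI hIc hJ hJc hU hUc
  · intro v hv
    obtain ⟨ξ, η, hξ, hη, h⟩ :=
      (TodaSym.isFieldSymmetry_finite_iff hN hI hIc hJ hJc hU hUc v).1 hv
    exact TodaSym.inheritedFromSemi_of_conformal hI hJ hξ hη h
  · exact TodaSym.isLatticeSymmetry_finite_iff hN hI hIc hU hUc
  · rintro s (rfl | rfl) v hv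
    exacts [TodaSym.inheritedFromInfinite_A hI hIc hJ hJc hv,
      TodaSym.inheritedFromInfinite_C hI hIc hJ hJc hv]
  · rintro s (rfl | rfl)
    exacts [TodaSym.exists_not_inherited_B hI hIc hJ hJc,
      TodaSym.exists_not_inherited_D hI hIc hJ hJc]
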